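/- Let $A$ be a finite-dimensional real alternative algebra with unit, $\dim_{\mathbb R}A>1$, with a *-involution $x\mapsto x^c$ (a real linear map with $(x^c)^c=x$, $(xy)^c=y^cx^c$, $r^c=r$ for $r\in\mathbb R$). Put $t(x)=x+x^c$, $n(x)=xx^c$, $$Q_A=\mathbb R\cup\{x\in A: t(x),n(x)\in\mathbb R,\ t(x)^2-4n(x)<0\},\qquad \mathbb S_A=\{J\in Q_A: J^2=-1\},$$ and for $J\in\mathbb S_A$ let $\mathbb C_J=\langle 1,J\rangle=\{\rho+\sigma J:\rho,\sigma\in\mathbb R\}$. Let $A_{\mathbb C}=A\otimes_{\mathbb R}\mathbb C=\{a+b\iota: a,b\in A\}$ with $\iota^2=-1$, product $(a+b\iota)(a'+b'\iota)=(aa'-bb')+(ab'+ba')\iota$ and conjugation $\overline{a+b\iota}=a-b\iota$. For $D\subseteq\mathbb C$ invariant under complex conjugation let $\Omega_D=\{r+sK: r,s\in\mathbb R,\ K\in\mathbb S_A,\ r+si\in D\}$. A stem function on $D$ is a map $F=F_1+F_2\iota:D\to A_{\mathbb C}$ with $F(\bar z)=\overline{F(z)}$; it induces the left slice function $\mathcal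 I(F):\Omega_D\to A$, $\mathcal I(F)(r+sK)=F_1(r+si)+K\,F_2(r+si)$. The slice product is $\mathcal I(F)\cdot\mathcal I(G)=\mathcal I(FG)$, and for $F$ of class $C^1$ and $f=\mathcal I(F)$ one puts $\frac{\partial f}{\partial x^c}=\mathcal I\big(\tfrac12(\frac{\partial F}{\partial r}+\frac{\partial F}{\partial s}\iota)\big)$. For $y\in Q_A$ the Cauchy kernel is the slice function $C_y=\mathcal I\big((z^2-z\,t(y)+n(y))^{-1}(y^c-z)\big)$ (where $z=r+si$ is identified with $r+s\iota\in A_{\mathbb C}$), defined where $z^2-z\,t(y)+n(y)\ne0$. **Theorem.** Let $D\subseteq\mathbb C$ be a bounded domain invariant under complex conjugation, let $J\in\mathbb S_A$ and $D_J=\Omega_D\cap\mathbb C_J$. Assume that the boundary $\partial D_J$ of $D_J$ in $\mathbb C_J\cong\mathbb C$ is piecewise $C^1$: it is the union of the images of finitely many pairwise disjoint piecewise $C^1$ Jordan curves $\alpha_i:[a_i,b_i]\to\mathbb C_J$ $(1\le i\le m)$, positively oriented, i.e. the sum of their winding numbers is $1$ about each point of $D_J$ and $0$ about each point outside $\overline{D_J}$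 (for $m=1$: a counterclockwise oriented Jordan curve). Let $F\in C^1(\overline D;A_{\mathbb C})$, i.e. $F$ is continuous on $\overline D$, of class $C^1$ on $D$, and its first derivatives extend continuously to $\overline D$; assume that $F$ is a stem function and let $f=\mathcal I(F)$ (defined also on $\partial D_J$ through the values of $F$ on $\partial D$). Then for every $x\in\Omega_D$ $$f(x)=\frac1{2\pi}\int_{\partial D_J}\Big[C_y\cdot\big(J^{-1}dy\,f(y)\big)\Big](x)-\frac1{2\pi}\int_{D_J}\Big[C_y\cdot\Big(J^{-1}dy^c\wedge dy\,\frac{\partial f}{\partial y^c}(y)\Big)\Big](x),$$ where, with the slice products taken in the variable $x$ between $C_y$ and a constant function, the two integrals are by definition $$\sum_{i=1}^m\int_{a_i}^{b_i}\Big[C_{\alpha_i(t)}\cdot\big(J^{-1}\alpha_i'(t)\,f(\alpha_i(t))\big)\Big](x)\,dt\qquad\text{and}\qquad 2\int_{D_J}\Big[C_{\rho+\sigma J}\cdot\frac{\partial f}{\partial y^c}(\rho+\sigma J)\Big](x)\,d\rho\,d\sigma,$$ and all the integrands are Lebesgue integrable. -/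

import Mathlib

open MeasureTheory

namespace SliceCauchy

/-! ### Finite-dimensional real alternative *-algebras -/

/-- A unital, not necessarily associative ring carrying a norm on its additive group.  The norm only
serves to fix the topology and the meaning of derivatives and integrals; no compatibility with the
multiplication is required (on a finite-dimensional real algebra all norms are equivalent). -/
class NormedNonAssocRing (A : Type*) extends NormedAddCommGroup A, NonAssocRing A

/-- The ring is alternative: the associator `(x y) z - x (y z)` is an alternating function. -/
class IsAlternative (A : Type*) [NonAssocRing A] : Prop where
  associator_left : ∀ x y : A, associator x x y = 0
  associator_right : ∀ x y : A, associator x y y = 0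
  associator_flexible : ∀ x y : A, associator x y x = 0

section Algebra

variable {A : Type*} [NormedNonAssocRing A] [NormedSpace ℝ A] [StarRing A]

/-- The quadratic cone `Q_A`: the real numbers together with the elements whose trace
`t(x) = x + xᶜ` and squared norm `n(x) = x xᶜ` are real and satisfy `t(x)² - 4 n(x) < 0`. -/
def quadraticCone (A : Type*) [NormedNonAssocRing A] [NormedSpace ℝ A] [StarRing A] : Set A :=
  {x | (∃ r : ℝ, x = r • (1 : A)) ∨
    ∃ t n : ℝ, x + star x = t • (1 : A) ∧ x * star x = n • (1 : A) ∧ t ^ 2 - 4 * n < 0}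

/-- The set `𝕊_A` of square roots of `-1` in the quadratic cone. -/
def imaginaryUnits (A : Type*) [NormedNonAssocRing A] [NormedSpace ℝ A] [StarRing A] : Set A :=
  {J | J ∈ quadraticCone A ∧ J * J = -1}

/-- The map `φ_J : ℂ → A`, `r + s i ↦ r + s J`. -/
noncomputable def phi (J : A) (z : ℂ) : A := z.re • (1 : A) + z.im • J

/-- The plane `ℂ_J = ⟨1, J⟩`. -/
def slicePlane (J : A) : Set A := (Submodule.span ℝ {1, J} : Submodule ℝ A)

/-- The circular set `Ω_D = {r + s K : K ∈ 𝕊_A, r + s i ∈ D}`. -/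
def circularSet (A : Type*) [NormedNonAssocRing A] [NormedSpace ℝ A] [StarRing A]
    (D : Set ℂ) : Set A :=
  {x | ∃ K ∈ imaginaryUnits A, ∃ z ∈ D, x = phi K z}

/-- `D_J = Ω_D ∩ ℂ_J`. -/
def sliceDomain (D : Set ℂ) (J : A) : Set A := circularSet A D ∩ slicePlane J

open Classical in
/-- The real number `r` with `a = r • 1`, if there is one (and `0` otherwise). -/
noncomputable def toReal (a : A) : ℝ := if h : ∃ r : ℝ, a = r • (1 : A) then h.choose else 0

/-- The trace `t(y) = y + yᶜ`, as a real number. -/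
noncomputable def trace (y : A) : ℝ := toReal (y + star y)

/-- The squared norm `n(y) = y yᶜ`, as a real number. -/
noncomputable def sqNorm (y : A) : ℝ := toReal (y * star y)

end Algebra

/-! ### The complexification of the algebra -/

/-- The complexification `A_ℂ = A ⊗ ℂ ≃ A²`; `⟨x, y⟩` stands for `x + y ι`. -/
@[ext] structure Complexification (A : Type*) where
  re : A
  im : A

namespace Complexification

variable {A : Type*} [NormedNonAssocRing A] [NormedSpace ℝ A]

/-- `(x + y ι) (x' + y' ι) = (x x' - y y') + (x y' + y x') ι`. -/
instance : Mul (Complexification A) :=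
  ⟨fun v w => ⟨v.re * w.re - v.im * w.im, v.re * w.im + v.im * w.re⟩⟩

/-- `(r + s i) (x + y ι) = (r x - s y) + (r y + s x) ι`. -/
noncomputable instance : SMul ℂ (Complexification A) :=
  ⟨fun c v => ⟨c.re • v.re - c.im • v.im, c.re • v.im + c.im • v.re⟩⟩

/-- The complex conjugation `x + y ι ↦ x - y ι`. -/
def conj (v : Complexification A) : Complexification A := ⟨v.re, -v.im⟩

end Complexification

/-! ### Stem functions, slice functions, slice product -/

section Slice

variable {A : Type*} [NormedNonAssocRing A] [NormedSpace ℝ A]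

/-- `F` is a stem function on `D`. -/
def IsStem (D : Set ℂ) (F : ℂ → Complexification A) : Prop :=
  ∀ z ∈ D, F (starRingEnd ℂ z) = (F z).conj

variable [StarRing A]

open Classical in
/-- The left slice function `𝓘(F)`: for `x = r + s K` with `K ∈ 𝕊_A` and `z = r + s i`, its value at
`x` is `F₁(z) + K F₂(z)`.  For a stem function this does not depend on the choice of `K` and `z`, see
`sliceFunction_phi`.  (Value `0` outside the quadratic cone.) -/
noncomputable def sliceFunction (F : ℂ → Complexification A) (x : A) : A :=
  if h : ∃ p : A × ℂ, p.1 ∈ imaginaryUnits A ∧ x = phi p.1 p.2 then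
    (F h.choose.2).re + h.choose.1 * (F h.choose.2).im
  else 0

/-- The slice product `𝓘(F) · 𝓘(G) = 𝓘(F G)` of the slice functions with stem functions `F`, `G`. -/
noncomputable def sliceProduct (F G : ℂ → Complexification A) : A → A :=
  sliceFunction (fun z => F z * G z)

/-- The stem function of the constant slice function `a`. -/
def constStem (a : A) : ℂ → Complexification A := fun _ => ⟨a, 0⟩

/-- The stem function `z ↦ (z² - z t(y) + n(y))⁻¹ (yᶜ - z)` of the Cauchy kernel `C_y`.
Here `yᶜ - z` is the element `(yᶜ - r) - s ι` of `A_ℂ`, for `z = r + s i`. -/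
noncomputable def cauchyKernelStem (y : A) : ℂ → Complexification A := fun z =>
  (z ^ 2 - z * (trace y : ℂ) + (sqNorm y : ℂ))⁻¹ •
    (⟨star y - z.re • (1 : A), -(z.im • (1 : A))⟩ : Complexification A)

/-- The stem function `∂F/∂z̄ = (1/2) (∂F/∂r + (∂F/∂s) ι)`, `z = r + s i`, written out in
components. -/
noncomputable def dbarStem (F : ℂ → Complexification A) : ℂ → Complexification A := fun z =>
  ⟨(1 / 2 : ℝ) • (fderiv ℝ (fun w => (F w).re) z 1 - fderiv ℝ (fun w => (F w).im) z Complex.I),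
   (1 / 2 : ℝ) • (fderiv ℝ (fun w => (F w).im) z 1 + fderiv ℝ (fun w => (F w).re) z Complex.I)⟩

/-- `∂f/∂xᶜ = 𝓘(∂F/∂z̄)` for `f = 𝓘(F)`. -/
noncomputable def sliceDbar (F : ℂ → Complexification A) : A → A := sliceFunction (dbarStem F)

/-- `G ∈ C¹(D̄; A)`: `G` is of class `C¹` on the open set `D`, and `G` and its (real) derivative
extend continuously to the closure of `D`, the extension of `G` being given by `G` itself. -/
structure IsC1OnClosure (D : Set ℂ) (G : ℂ → A) : Prop where
  contDiffOn : ContDiffOn ℝ 1 G D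
  continuousOn : ContinuousOn G (closure D)
  deriv_extends : ∃ G' : ℂ → (ℂ →L[ℝ] A), ContinuousOn G' (closure D) ∧ ∀ z ∈ D, G' z = fderiv ℝ G z

end Slice

/-! ### Piecewise `C¹` boundaries -/

/-- `γ : [a, b] → ℂ` is a piecewise `C¹` Jordan curve. -/
structure IsPiecewiseC1JordanCurve (γ : ℝ → ℂ) (a b : ℝ) : Prop where
  lt : a < b
  continuousOn : ContinuousOn γ (Set.Icc a b)
  piecewise : ∃ S : Finset ℝ, ∀ c d : ℝ, a ≤ c → c < d → d ≤ b →
    (∀ t ∈ S, t ∉ Set.Ioo c d) → ContDiffOn ℝ 1 γ (Set.Icc c d)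
  closed : γ a = γ b
  simple : Set.InjOn γ (Set.Ico a b)

/-- The winding number of the closed curve `γ : [a, b] → ℂ` about `z`. -/
noncomputable def windingNumber (γ : ℝ → ℂ) (a b : ℝ) (z : ℂ) : ℂ :=
  (2 * Real.pi * Complex.I)⁻¹ * ∫ t in a..b, deriv γ t / (γ t - z)

/-- The boundary of `U ⊆ ℂ` is piecewise `C¹` and the curves `γ i : [a i, b i] → ℂ` parametrize it
with its positive orientation: they are finitely many disjoint piecewise `C¹` Jordan curves which
together make up the boundary, and they are oriented so that they wind once around the points of `U`
and zero times around the points outside the closure of `U`.  For a single curve this is the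
counterclockwise orientation. -/
structure IsPiecewiseC1Boundary (U : Set ℂ) {m : ℕ} (γ : Fin m → ℝ → ℂ) (a b : Fin m → ℝ) :
    Prop where
  jordan : ∀ i, IsPiecewiseC1JordanCurve (γ i) (a i) (b i)
  disjoint : Pairwise fun i j =>
    Disjoint (γ i '' Set.Icc (a i) (b i)) (γ j '' Set.Icc (a j) (b j))
  frontier_eq : frontier U = ⋃ i, γ i '' Set.Icc (a i) (b i)
  winding_inside : ∀ z ∈ U, ∑ i, windingNumber (γ i) (a i) (b i) z = 1
  winding_outside : ∀ z ∉ closure U, ∑ i, windingNumber (γ i) (a i) (b i) z = 0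

/-! ### The integrands of the Cauchy formula -/

section Integrands

variable {A : Type*} [NormedNonAssocRing A] [NormedSpace ℝ A] [StarRing A]

/-- `[C_{α(t)} · (J⁻¹ α'(t) f(α(t)))](x)` with `f = 𝓘(F)` and the slice product taken in the variable
`x`; note `J⁻¹ = -J`. -/
noncomputable def boundaryIntegrand (J : A) (F : ℂ → Complexification A) (α : ℝ → A) (x : A)
    (t : ℝ) : A :=
  sliceProduct (cauchyKernelStem (α t))
    (constStem (((-J) * deriv α t) * sliceFunction F (α t))) x

/-- `[C_y · ∂f/∂yᶜ(y)](x)` at `y = ρ + σ J`, where `f = 𝓘(F)`, `w = ρ + σ i`, and the slice product is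
taken in the variable `x`. -/
noncomputable def areaIntegrand (J : A) (F : ℂ → Complexification A) (x : A) (w : ℂ) : A :=
  sliceProduct (cauchyKernelStem (phi J w)) (constStem (sliceDbar F (phi J w))) x

end Integrands

/-! ### Well-posedness of `sliceFunction` -/

section WellPosed

variable {A : Type*} [NormedNonAssocRing A] [NormedSpace ℝ A] [IsScalarTower ℝ A A]
  [SMulCommClass ℝ A A] [StarRing A]

theorem star_of_mem_imaginaryUnits [Nontrivial A] {K : A} (hK : K ∈ imaginaryUnits A) :
    star K = -K := by
  obtain ⟨hQ, hsq⟩ := hK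
  have notreal : ∀ r : ℝ, K ≠ r • (1 : A) := by
    intro r hr
    rw [hr, smul_mul_smul_comm, mul_one] at hsq
    have h2 : (r * r + 1) • (1 : A) = 0 := by rw [add_smul, hsq, one_smul]; simp
    rcases smul_eq_zero.mp h2 with h | h
    · nlinarith [mul_self_nonneg r]
    · exact one_ne_zero h
  rcases hQ with ⟨r, hr⟩ | ⟨t, n, ht, hn, -⟩
  · exact absurd hr (notreal r)
  · have hs : star K = t • (1 : A) - K := by rw [← ht]; abel
    rw [hs, mul_sub, hsq, mul_smul_comm, mul_one] at hn
    have h1 : t • K = (n - 1) • (1 : A) := by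
      rw [sub_smul, ← hn, one_smul]; abel
    by_cases h0 : t = 0
    · rw [hs, h0]; simp
    · exact absurd (by rw [mul_smul, ← h1, smul_smul, inv_mul_cancel₀ h0, one_smul])
        (notreal (t⁻¹ * (n - 1)))

variable [StarModule ℝ A]

theorem phi_eq_phi [Nontrivial A] {K L : A} (hK : K ∈ imaginaryUnits A)
    (hL : L ∈ imaginaryUnits A) {z w : ℂ} (h : phi K z = phi L w) :
    z.re = w.re ∧ z.im • K = w.im • L ∧ (z.im = w.im ∨ z.im = -w.im) := by
  have h' := congrArg star h
  simp only [phi, star_add, star_smul, star_one, star_trivial, star_of_mem_imaginaryUnits hK,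
    star_of_mem_imaginaryUnits hL, smul_neg] at h'
  simp only [phi] at h
  have hre : (2 * (z.re - w.re)) • (1 : A) = 0 := by
    have e : (2 * (z.re - w.re)) • (1 : A) =
        (z.re • (1 : A) + z.im • K) + (z.re • (1 : A) + -(z.im • K))
          - ((w.re • (1 : A) + w.im • L) + (w.re • (1 : A) + -(w.im • L))) := by
      module
    rw [e, h, h', sub_self]
  have hr : z.re = w.re := by
    rcases smul_eq_zero.mp hre with h0 | h0
    · linarith
    · exact absurd h0 one_ne_zero
  have him : z.im • K = w.im • L := by
    rw [hr] at h
    exact add_left_cancel h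
  refine ⟨hr, him, ?_⟩
  have hsq : (z.im • K) * (z.im • K) = (w.im • L) * (w.im • L) := by rw [him]
  rw [smul_mul_smul_comm, smul_mul_smul_comm, hK.2, hL.2] at hsq
  have h2 : (z.im * z.im - w.im * w.im) • (1 : A) = 0 := by
    rw [smul_neg, smul_neg, neg_inj] at hsq
    rw [sub_smul, hsq, sub_self]
  rcases smul_eq_zero.mp h2 with h0 | h0
  · exact mul_self_eq_mul_self_iff.mp (by linarith)
  · exact absurd h0 one_ne_zero

/-- `𝓘(F)(r + s K) = F₁(z) + K F₂(z)` for every `K ∈ 𝕊_A` and every `z = r + s i` in `D`. -/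
theorem sliceFunction_phi [Nontrivial A] {D : Set ℂ} {F : ℂ → Complexification A}
    (hF : IsStem D F) {K : A} (hK : K ∈ imaginaryUnits A) {z : ℂ} (hz : z ∈ D) :
    sliceFunction F (phi K z) = (F z).re + K * (F z).im := by
  have hex : ∃ p : A × ℂ, p.1 ∈ imaginaryUnits A ∧ phi K z = phi p.1 p.2 := ⟨(K, z), hK, rfl⟩
  rw [sliceFunction, dif_pos hex]
  obtain ⟨hL, he⟩ := hex.choose_spec
  set L := hex.choose.1
  set w := hex.choose.2
  obtain ⟨h1, h2, h3⟩ := phi_eq_phi hK hL he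
  have hzc := hF z hz
  by_cases h0 : z.im = 0
  · have hw : w = z := by
      apply Complex.ext h1.symm
      rcases h3 with h3 | h3 <;> linarith
    have hzz : starRingEnd ℂ z = z := Complex.conj_eq_iff_im.mpr h0
    rw [hzz] at hzc
    have him : (F z).im = -(F z).im := congrArg Complexification.im hzc
    have hzero : (F z).im = 0 := by
      have h4 : (2 : ℝ) • (F z).im = 0 := by
        rw [two_smul]; nth_rewrite 2 [him]; exact add_neg_cancel _
      exact (smul_eq_zero.mp h4).resolve_left two_ne_zero
    rw [hw, hzero, mul_zero, mul_zero]
  · rcases h3 with h3 | h3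
    · have hw : w = z := Complex.ext h1.symm h3.symm
      rw [← h3] at h2
      have hKL : K = L := smul_right_injective A h0 h2
      rw [hw, ← hKL]
    · have hw : w = starRingEnd ℂ z := by
        apply Complex.ext
        · simp [h1]
        · simp [h3]
      have hwi : w.im = -z.im := by linarith
      rw [hwi, neg_smul, ← smul_neg] at h2
      have hKL : K = -L := smul_right_injective A h0 h2
      rw [hw, hzc, hKL]
      simp [Complexification.conj]

end WellPosed

end SliceCauchy

open SliceCauchy

namespace SliceCauchy

open Complex Metric Set Filter Topology

/-! The formula reduces to the planar Cauchy–Pompeiu formula, used at two points. Since `A` is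
alternative and `J * J = -1`, left multiplication satisfies `J * (J * a) = -a`, so `A` is a complex
vector space on which `phi J z` acts as the scalar `z`. The restriction of `f` to the slice of `J`
is `g = F₁ + J F₂`, and the slice derivative restricts to the ordinary `∂/∂z̄` of `g`. For `x = phi
K z`, the representation formula (`re_add_mul_im_eq_representation`) gives `f x` as `R₁ (g z) + R₂
(g z̄)`, with real linear maps `R₁`, `R₂` depending only on `J` and `K`. The kernel obeys the same
rule (`sliceProduct_cauchyKernelStem`): because `z² - z t(y) + n(y) = (ζ - z)(ζ̄ - z)` for `y = phi
J ζ`, its slice product with a constant is the same combination of the classical kernels `(ζ - z)⁻¹`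
and `(ζ - z̄)⁻¹`. Hence `leftCauchyPompeiu` at `z` and at `z̄`, combined by `R₁` and `R₂`, is the
claim.

The planar formula is proved without Green's theorem on the domain. A compactly supported `C¹`
function `G` is the Cauchy transform of its Wirtinger derivative (`integral_wirtinger_div_sub`, by
polar coordinates). Integrating this representation along the boundary and exchanging integrals
leaves the contour integral of `1 / ((ζ - z)(ζ - w))`, which partial fractions express through
winding numbers (`sum_integral_deriv_div_div`).

A function that is `C¹` only up to the boundary is extended continuously and mollified
(`cauchyPompeiu`). Near the boundary the mollified derivative may grow like `o(1) / ε`, but a strip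
of width `ε` has area `O(ε)`, so its contribution vanishes in the limit. -/

/-! ### The Cauchy–Pompeiu formula in the plane -/

/-- The Wirtinger derivative `∂G/∂z̄` of a complex-valued function. -/
noncomputable def wirtinger (G : ℂ → ℂ) (w : ℂ) : ℂ :=
  (1 / 2 : ℂ) * (fderiv ℝ G w 1 + I * fderiv ℝ G w I)

theorem norm_wirtinger_le (G : ℂ → ℂ) (w : ℂ) : ‖wirtinger G w‖ ≤ ‖fderiv ℝ G w‖ := by
  have h1 := (fderiv ℝ G w).le_opNorm 1
  have h2 := (fderiv ℝ G w).le_opNorm I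
  have h3 := norm_add_le (fderiv ℝ G w 1) (I * fderiv ℝ G w I)
  simp only [norm_one, mul_one, norm_I, norm_mul, one_mul] at h1 h2 h3
  rw [wirtinger, norm_mul]
  norm_num
  linarith

theorem continuous_wirtinger {G : ℂ → ℂ} (hG : ContDiff ℝ 1 G) : Continuous (wirtinger G) := by
  have := hG.continuous_fderiv one_ne_zero
  unfold wirtinger
  fun_prop

theorem hasCompactSupport_wirtinger {G : ℂ → ℂ} (hG : HasCompactSupport G) :
    HasCompactSupport (wirtinger G) := by
  refine (hG.fderiv (𝕜 := ℝ)).mono fun w hw => ?_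
  contrapose! hw
  simp only [Function.mem_support, not_not] at hw ⊢
  simp [wirtinger, hw]

/-- In polar coordinates the Jacobian `r` cancels the singularity `r⁻¹`. -/
theorem integrableOn_inv_norm_ball (R : ℝ) :
    IntegrableOn (fun w : ℂ => ‖w‖⁻¹) (ball 0 R) := by
  have h := integrable_fun_norm_addHaar (volume : Measure ℂ)
    (f := fun y : ℝ => (Iio R).indicator (fun y => y⁻¹) y)
  rw [← integrable_indicator_iff measurableSet_ball]
  have e : (ball (0 : ℂ) R).indicator (fun w : ℂ => ‖w‖⁻¹) =
      fun w => (Iio R).indicator (fun y : ℝ => y⁻¹) ‖w‖ := by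
    ext w; simp [indicator]
  rw [e, h]
  have : IntegrableOn (fun _ : ℝ => (1 : ℝ)) (Ioo 0 R) := by simp
  rw [← integrable_indicator_iff measurableSet_Ioo] at this
  refine (this.integrableOn (s := Ioi 0)).congr_fun (fun y hy => ?_) measurableSet_Ioi
  have hy' : (0 : ℝ) < y := hy
  simp only [indicator, mem_Ioo, hy', true_and, mem_Iio, finrank_real_complex]
  split_ifs <;> simp [hy'.ne']

/-- Translation by `ζ` carries the ball into the centred ball of radius `R + ‖ζ‖`. The bound depends
on `ζ` only through `‖ζ‖`, which later makes it uniform along a bounded curve. -/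
theorem integrableOn_inv_norm_sub (R : ℝ) (ζ : ℂ) :
    IntegrableOn (fun w : ℂ => ‖w - ζ‖⁻¹) (ball 0 R) ∧
      ∫ w in ball 0 R, ‖w - ζ‖⁻¹ ≤ ∫ w : ℂ in ball 0 (R + ‖ζ‖), ‖w‖⁻¹ := by
  have hmp := measurePreserving_sub_right (volume : Measure ℂ) ζ
  have hemb : MeasurableEmbedding (fun w : ℂ => w - ζ) := measurableEmbedding_subRight ζ
  have hsub : ball 0 R ⊆ (fun w : ℂ => w - ζ) ⁻¹' ball 0 (R + ‖ζ‖) := fun w hw => by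
    rw [mem_ball_zero_iff] at hw
    rw [mem_preimage, mem_ball_zero_iff]
    linarith [norm_sub_le w ζ]
  have h1 : IntegrableOn (fun w : ℂ => ‖w - ζ‖⁻¹) ((fun w : ℂ => w - ζ) ⁻¹' ball 0 (R + ‖ζ‖)) :=
    (hmp.integrableOn_comp_preimage hemb (f := fun w : ℂ => ‖w‖⁻¹)).mpr
      (integrableOn_inv_norm_ball _)
  refine ⟨h1.mono_set hsub, ?_⟩
  rw [← hmp.setIntegral_preimage_emb hemb (fun w : ℂ => ‖w‖⁻¹)]
  exact setIntegral_mono_set h1 (Eventually.of_forall fun w => by positivity)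
    hsub.eventuallyLE

/-- A bounded measurable function supported in a ball stays integrable after division by `w - ζ`,
with a bound for the integral which is uniform for `ζ` in bounded sets. -/
theorem integrable_div_sub {q : ℂ → ℂ} (hq : AEStronglyMeasurable q volume) {R M : ℝ} (hM : 0 ≤ M)
    (hqM : ∀ w, ‖q w‖ ≤ M) (hqR : ∀ w, w ∉ ball 0 R → q w = 0) (ζ : ℂ) :
    Integrable (fun w => q w / (w - ζ)) ∧
      ∫ w, ‖q w / (w - ζ)‖ ≤ M * ∫ w : ℂ in ball 0 (R + ‖ζ‖), ‖w‖⁻¹ := by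
  obtain ⟨h1, h2⟩ := integrableOn_inv_norm_sub R ζ
  have h3 := (integrable_indicator_iff measurableSet_ball).mpr (h1.const_mul M)
  have hle : ∀ w, ‖q w / (w - ζ)‖ ≤ (ball 0 R).indicator (fun w : ℂ => M * ‖w - ζ‖⁻¹) w := by
    intro w
    by_cases hw : w ∈ ball 0 R
    · rw [indicator_of_mem hw, norm_div, div_eq_mul_inv]
      exact mul_le_mul_of_nonneg_right (hqM w) (by positivity)
    · rw [indicator_of_notMem hw, hqR w hw]; simp
  have hi : Integrable (fun w => q w / (w - ζ)) :=
    h3.mono' (hq.div₀ (by fun_prop)) (Eventually.of_forall hle)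
  refine ⟨hi, (integral_mono hi.norm h3 hle).trans ?_⟩
  rw [integral_indicator measurableSet_ball, integral_const_mul]
  exact mul_le_mul_of_nonneg_left h2 hM

theorem exists_bound_of_hasCompactSupport {q : ℂ → ℂ} (hq : Continuous q)
    (hs : HasCompactSupport q) :
    ∃ R M : ℝ, 0 < R ∧ 0 ≤ M ∧ (∀ w, ‖q w‖ ≤ M) ∧ ∀ w, w ∉ ball 0 R → q w = 0 := by
  obtain ⟨M, hM⟩ := hq.bounded_above_of_compact_support hs
  obtain ⟨R, hR0, hR⟩ := hs.isBounded.subset_ball_lt 0 0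
  exact ⟨R, M, hR0, (norm_nonneg _).trans (hM 0), hM, fun w hw =>
    image_eq_zero_of_notMem_tsupport fun h => hw (hR h)⟩

theorem integrableOn_polar_of_continuous {u : ℝ × ℝ → ℂ} (hu : Continuous u) {R : ℝ}
    (hR : ∀ p : ℝ × ℝ, R ≤ p.1 → u p = 0) :
    Integrable u ((volume.restrict (Ioi (0 : ℝ))).prod
      (volume.restrict (Ioo (-Real.pi) Real.pi))) := by
  rw [Measure.prod_restrict]
  change IntegrableOn u _ _
  have h1 : IntegrableOn u (Ioc 0 R ×ˢ Ioo (-Real.pi) Real.pi) (volume.prod volume) :=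
    (hu.continuousOn.integrableOn_compact (isCompact_Icc.prod isCompact_Icc)).mono_set
      (prod_mono Ioc_subset_Icc_self Ioo_subset_Icc_self)
  refine h1.of_forall_sdiff_eq_zero (measurableSet_Ioi.prod measurableSet_Ioo) fun p hp => ?_
  refine hR p ?_
  by_contra h
  exact hp.2 ⟨⟨hp.1.1, (not_le.mp h).le⟩, hp.1.2⟩

/-- In polar coordinates the integrand times the Jacobian becomes `½ (∂G/∂r + (i/r) ∂G/∂θ)`. The
radial term integrates to `-G 0` on every ray, and the angular term integrates to zero over a full
period. -/
theorem integral_wirtinger_div_self {G : ℂ → ℂ} (hG : ContDiff ℝ 1 G) (hs : HasCompactSupport G) :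
    ∫ w, wirtinger G w / w = -(Real.pi * G 0) := by
  obtain ⟨R, hR0, hR⟩ := hs.isBounded.subset_ball_lt 0 0
  have hcf := hG.continuous_fderiv one_ne_zero
  set e : ℝ → ℂ := fun θ => Real.cos θ + Real.sin θ * I with he
  have hec : Continuous e := by fun_prop
  have hen : ∀ θ, ‖e θ‖ = 1 := fun θ => by
    simp only [he, ofReal_cos, ofReal_sin]; exact norm_cos_add_sin_mul_I θ
  have hed : ∀ θ, HasDerivAt e (I * e θ) θ := fun θ => by
    have h1 := (Real.hasDerivAt_cos θ).ofReal_comp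
    have h2 := ((Real.hasDerivAt_sin θ).ofReal_comp).mul_const I
    refine (h1.add h2).congr_deriv ?_
    simp only [he]; push_cast; ring_nf; simp only [I_sq]; ring
  let u : ℝ × ℝ → ℂ := fun p => fderiv ℝ G (p.1 * e p.2) (e p.2)
  let v : ℝ × ℝ → ℂ := fun p => fderiv ℝ G (p.1 * e p.2) (I * e p.2)
  have hfd : ∀ p : ℝ × ℝ, R ≤ p.1 → fderiv ℝ G (p.1 * e p.2) = 0 := fun p hp => by
    refine image_eq_zero_of_notMem_tsupport fun h => ?_
    have := hR (tsupport_fderiv_subset ℝ h)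
    rw [mem_ball_zero_iff, norm_mul, hen, mul_one, norm_real, Real.norm_eq_abs] at this
    linarith [le_abs_self p.1]
  have huc : Continuous u := by fun_prop
  have hvc : Continuous v := by fun_prop
  have hui := integrableOn_polar_of_continuous huc (R := R) fun p hp => by simp [u, hfd p hp]
  have hvi := integrableOn_polar_of_continuous hvc (R := R) fun p hp => by simp [v, hfd p hp]
  have key : ∫ w, wirtinger G w / w = (1 / 2 : ℂ) *
      (∫ p, u p ∂((volume.restrict (Ioi (0 : ℝ))).prod
        (volume.restrict (Ioo (-Real.pi) Real.pi))) + I *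
      ∫ p, v p ∂((volume.restrict (Ioi (0 : ℝ))).prod
        (volume.restrict (Ioo (-Real.pi) Real.pi)))) := by
    rw [← integral_const_mul, ← integral_add hui (hvi.const_mul I), ← integral_const_mul,
      ← Complex.integral_comp_polarCoord_symm, polarCoord_target, Measure.prod_restrict]
    refine setIntegral_congr_fun (measurableSet_Ioi.prod measurableSet_Ioo) fun p hp => ?_
    have hp0 : (p.1 : ℂ) ≠ 0 := by exact_mod_cast (ne_of_gt hp.1)
    have he0 : e p.2 ≠ 0 := by rw [← norm_pos_iff, hen]; exact one_pos
    have hsym : Complex.polarCoord.symm p = p.1 * e p.2 := by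
      rw [Complex.polarCoord_symm_apply]
    simp only [hsym, u, v, wirtinger, real_smul]
    have hd1 : e p.2 = Real.cos p.2 • (1 : ℂ) + Real.sin p.2 • I := by simp [he]
    have hd2 : I * e p.2 = (-Real.sin p.2) • (1 : ℂ) + Real.cos p.2 • I := by
      simp only [he, real_smul]; push_cast; ring_nf; simp only [I_sq]; ring
    have hu' : ∀ L : ℂ →L[ℝ] ℂ, L (e p.2) = Real.cos p.2 * L 1 + Real.sin p.2 * L I := fun L => by
      rw [hd1, map_add, map_smul, map_smul, real_smul, real_smul]
    have hv' : ∀ L : ℂ →L[ℝ] ℂ, L (I * e p.2) = -Real.sin p.2 * L 1 + Real.cos p.2 * L I :=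
      fun L => by rw [hd2, map_add, map_smul, map_smul, real_smul, real_smul]; push_cast; ring
    rw [hu', hv']
    set L := fderiv ℝ G (p.1 * e p.2)
    have hcs : (Real.cos p.2 : ℂ) ^ 2 + (Real.sin p.2 : ℂ) ^ 2 = 1 := by
      exact_mod_cast Real.cos_sq_add_sin_sq p.2
    field_simp
    simp only [he]
    linear_combination (-(L 1 + I * L I)) * hcs +
      (L 1 * Real.sin p.2 ^ 2 - L I * Real.cos p.2 * Real.sin p.2) * I_sq
  have hGc : ∀ p : ℝ × ℝ, HasFDerivAt G (fderiv ℝ G (p.1 * e p.2)) (p.1 * e p.2) := fun p =>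
    (hG.differentiable one_ne_zero _).hasFDerivAt
  have hu0 : ∫ p, u p ∂((volume.restrict (Ioi (0 : ℝ))).prod
        (volume.restrict (Ioo (-Real.pi) Real.pi))) = -(2 * Real.pi * G 0) := by
    rw [integral_prod_symm _ hui]
    have : ∀ θ : ℝ, ∫ r in Ioi (0 : ℝ), u (r, θ) = - G 0 := fun θ => by
      have hd : ∀ r : ℝ, HasDerivAt (fun r : ℝ => G (r * e θ)) (u (r, θ)) r := fun r => by
        have h1 : HasDerivAt (fun r : ℝ => (r : ℂ) * e θ) (e θ) r := by
          simpa using (hasDerivAt_id r).ofReal_comp.mul_const (e θ)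
        exact (hGc (r, θ)).comp_hasDerivAt r h1
      have hds : deriv (fun r : ℝ => G (r * e θ)) = fun r => u (r, θ) :=
        funext fun r => (hd r).deriv
      have hcd : ContDiff ℝ 1 (fun r : ℝ => G (r * e θ)) :=
        hG.comp (ofRealCLM.contDiff.mul contDiff_const)
      have hcs : HasCompactSupport (fun r : ℝ => G (r * e θ)) := by
        refine HasCompactSupport.intro (isCompact_Icc (a := -R) (b := R)) fun r hr => ?_
        refine image_eq_zero_of_notMem_tsupport fun h => hr ?_
        have := hR h
        rw [mem_ball_zero_iff, norm_mul, hen, mul_one, norm_real, Real.norm_eq_abs] at this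
        exact abs_le.mp this.le
      have := hcs.integral_Ioi_deriv_eq hcd 0
      rw [hds] at this
      simpa using this
    simp only [this]
    rw [setIntegral_const]
    simp [Measure.real, Real.volume_Ioo, Real.pi_pos.le, ENNReal.toReal_ofReal, ← two_mul]
  have hv0 : ∫ p, v p ∂((volume.restrict (Ioi (0 : ℝ))).prod
        (volume.restrict (Ioo (-Real.pi) Real.pi))) = 0 := by
    rw [integral_prod _ hvi]
    refine setIntegral_eq_zero_of_forall_eq_zero fun r hr => ?_
    have hr0 : (r : ℂ) ≠ 0 := by exact_mod_cast (ne_of_gt hr)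
    have hd : ∀ θ : ℝ, HasDerivAt (fun θ : ℝ => G (r * e θ)) (r * v (r, θ)) θ := fun θ => by
      refine ((hGc (r, θ)).comp_hasDerivAt θ ((hed θ).const_mul (r : ℂ))).congr_deriv ?_
      simp only [v]
      rw [← real_smul (x := r) (z := I * e θ), map_smul, real_smul]
    have h1 := intervalIntegral.integral_eq_sub_of_hasDerivAt (a := -Real.pi) (b := Real.pi)
      (fun θ _ => hd θ) ((by fun_prop : Continuous fun θ => (r : ℂ) * v (r, θ)).intervalIntegrable _ _)
    have hpi : e Real.pi = e (-Real.pi) := by simp [he]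
    rw [hpi, sub_self, intervalIntegral.integral_const_mul,
      intervalIntegral.integral_of_le (by linarith [Real.pi_pos]),
      integral_Ioc_eq_integral_Ioo] at h1
    exact (mul_eq_zero.mp h1).resolve_left hr0
  rw [key, hu0, hv0]; ring

theorem integral_wirtinger_div_sub {G : ℂ → ℂ} (hG : ContDiff ℝ 1 G) (hs : HasCompactSupport G)
    (ζ : ℂ) : ∫ w, wirtinger G w / (w - ζ) = -(Real.pi * G ζ) := by
  have h := integral_wirtinger_div_self (G := fun w => G (w + ζ))
    (hG.comp (contDiff_id.add contDiff_const)) (hs.comp_homeomorph (Homeomorph.addRight ζ))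
  rw [zero_add] at h
  rw [← h, ← integral_add_right_eq_self (fun w => wirtinger G w / (w - ζ)) ζ]
  refine integral_congr_ae (Eventually.of_forall fun w => ?_)
  simp [wirtinger, fderiv_comp_add_right]

/-- Superposition of the planar Cauchy–Pompeiu formula over a finite complex measure. -/
theorem integral_comp_mul_eq_wirtinger {T : Type*} [MeasurableSpace T] {μ : Measure T} [SFinite μ]
    {γ p : T → ℂ} (hγ : AEMeasurable γ μ) (hp : Integrable p μ) {B : ℝ}
    (hB : ∀ᵐ t ∂μ, ‖γ t‖ ≤ B) {G : ℂ → ℂ} (hG : ContDiff ℝ 1 G) (hs : HasCompactSupport G) :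
    Integrable (fun w => wirtinger G w * ∫ t, p t / (γ t - w) ∂μ) ∧
      ∫ t, G (γ t) * p t ∂μ =
        (1 / Real.pi : ℂ) * ∫ w, wirtinger G w * ∫ t, p t / (γ t - w) ∂μ := by
  obtain ⟨R, M, hR, hM, hqM, hqR⟩ := exists_bound_of_hasCompactSupport
    (continuous_wirtinger hG) (hasCompactSupport_wirtinger hs)
  have hm := (continuous_wirtinger hG).aestronglyMeasurable (μ := volume)
  have hI : Integrable (fun z : T × ℂ => wirtinger G z.2 * (p z.1 / (γ z.1 - z.2)))
      (μ.prod volume) := by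
    have hms : AEStronglyMeasurable (fun z : T × ℂ => wirtinger G z.2 * (p z.1 / (γ z.1 - z.2)))
        (μ.prod volume) := by
      refine AEStronglyMeasurable.mul hm.comp_snd (AEStronglyMeasurable.div₀ hp.1.comp_fst ?_)
      exact (hγ.comp_fst.sub measurable_snd.aemeasurable).aestronglyMeasurable
    have e : ∀ t w, wirtinger G w * (p t / (γ t - w)) =
        (-p t) * (wirtinger G w / (w - γ t)) := fun t w => by
      rw [← neg_sub w (γ t), div_neg]; ring
    rw [integrable_prod_iff hms]
    constructor
    · refine Eventually.of_forall fun t => ?_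
      simp only [e]
      exact (integrable_div_sub hm hM hqM hqR (γ t)).1.const_mul _
    -- The curve stays in the ball of radius `B`, so the inner integrals have one common bound and
    -- the integrability of `p` suffices for Fubini.
    · refine (hp.norm.mul_const (M * ∫ w : ℂ in ball 0 (R + B), ‖w‖⁻¹)).mono'
        hms.norm.integral_prod_right' ?_
      filter_upwards [hB] with t ht
      rw [Real.norm_of_nonneg (integral_nonneg fun _ => norm_nonneg _)]
      simp only [e, norm_mul, norm_neg]
      rw [integral_const_mul]
      refine mul_le_mul_of_nonneg_left ((integrable_div_sub hm hM hqM hqR (γ t)).2.trans ?_)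
        (norm_nonneg _)
      refine mul_le_mul_of_nonneg_left ?_ hM
      exact setIntegral_mono_set (integrableOn_inv_norm_ball _)
        (Eventually.of_forall fun w => by positivity)
        (ball_subset_ball (by linarith)).eventuallyLE
  have h1 := hI.integral_prod_right
  simp only [integral_const_mul] at h1
  refine ⟨h1, ?_⟩
  have h2 := integral_integral_swap
    (f := fun t w => wirtinger G w * (p t / (γ t - w))) hI
  simp only [integral_const_mul] at h2
  rw [← h2, ← integral_const_mul]
  refine integral_congr_ae (Eventually.of_forall fun t => ?_)
  have e : ∀ w, wirtinger G w * (p t / (γ t - w)) =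
        (-p t) * (wirtinger G w / (w - γ t)) := fun w => by
      rw [← neg_sub w (γ t), div_neg]; ring
  simp only [e]
  rw [integral_const_mul, integral_wirtinger_div_sub hG hs]
  have : (Real.pi : ℂ) ≠ 0 := by exact_mod_cast Real.pi_ne_zero
  field_simp

/-! ### Piecewise `C¹` curves -/

theorem lipschitzOnWith_Icc_union {γ : ℝ → ℂ} {c s d : ℝ} {C C' : NNReal}
    (h : LipschitzOnWith C γ (Icc c s)) (h' : LipschitzOnWith C' γ (Icc s d)) (hcs : c ≤ s)
    (hsd : s ≤ d) : LipschitzOnWith (max C C') γ (Icc c d) := by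
  have h1 := h.weaken (le_max_left C C')
  have h2 := h'.weaken (le_max_right C C')
  have key : ∀ x ∈ Icc c d, ∀ y ∈ Icc c d, x ≤ y →
      dist (γ x) (γ y) ≤ (max C C' : NNReal) * dist x y := by
    intro x hx y hy hxy
    rcases le_total y s with hys | hys
    · exact h1.dist_le_mul x ⟨hx.1, hxy.trans hys⟩ y ⟨hy.1, hys⟩
    · rcases le_total s x with hsx | hsx
      · exact h2.dist_le_mul x ⟨hsx, hx.2⟩ y ⟨hys, hy.2⟩
      · have e1 := h1.dist_le_mul x ⟨hx.1, hsx⟩ s ⟨hcs, le_rfl⟩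
        have e2 := h2.dist_le_mul s ⟨le_rfl, hsd⟩ y ⟨hys, hy.2⟩
        have e3 : dist x y = dist x s + dist s y := by
          rw [Real.dist_eq, Real.dist_eq, Real.dist_eq, abs_of_nonpos (by linarith),
            abs_of_nonpos (by linarith), abs_of_nonpos (by linarith)]
          ring
        rw [e3, mul_add]
        exact (dist_triangle _ _ _).trans (add_le_add e1 e2)
  refine LipschitzOnWith.of_dist_le_mul fun x hx y hy => ?_
  rcases le_total x y with hxy | hxy
  · exact key x hx y hy hxy
  · rw [dist_comm, dist_comm x y]; exact key y hy x hx hxy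

/-- Induction on the break points: one lying inside the interval splits it, and is then interior to
neither half. Without break points, `C¹` on a compact interval gives the Lipschitz bound. -/
theorem exists_lipschitzOnWith_of_piecewise {γ : ℝ → ℂ} (S : Finset ℝ) :
    ∀ a b : ℝ, a < b → (∀ c d : ℝ, a ≤ c → c < d → d ≤ b →
    (∀ t ∈ S, t ∉ Ioo c d) → ContDiffOn ℝ 1 γ (Icc c d)) →
    ∃ C, LipschitzOnWith C γ (Icc a b) := by
  induction S using Finset.induction_on with
  | empty =>
    intro a b hab h
    exact (h a b le_rfl hab le_rfl (by simp)).exists_lipschitzOnWith one_ne_zero (convex_Icc a b)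
      isCompact_Icc
  | insert s S _ ih =>
    intro a b hab h
    by_cases hs : s ∈ Ioo a b
    · obtain ⟨C, hC⟩ := ih a s hs.1 fun c d hac hcd hds hS => h c d hac hcd (hds.trans hs.2.le) (by
        simp only [Finset.mem_insert, forall_eq_or_imp]
        exact ⟨fun h' => absurd h'.2 (not_lt.mpr hds), hS⟩)
      obtain ⟨C', hC'⟩ := ih s b hs.2 fun c d hac hcd hds hS => h c d (hs.1.le.trans hac) hcd hds (by
        simp only [Finset.mem_insert, forall_eq_or_imp]
        exact ⟨fun h' => absurd h'.1 (not_lt.mpr hac), hS⟩)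
      exact ⟨_, lipschitzOnWith_Icc_union hC hC' hs.1.le hs.2.le⟩
    · exact ih a b hab fun c d hac hcd hdb hS => h c d hac hcd hdb (by
        simp only [Finset.mem_insert, forall_eq_or_imp]
        exact ⟨fun h' => hs ⟨hac.trans_lt h'.1, h'.2.trans_le hdb⟩, hS⟩)

theorem IsPiecewiseC1JordanCurve.exists_lipschitzOnWith {γ : ℝ → ℂ} {a b : ℝ}
    (h : IsPiecewiseC1JordanCurve γ a b) : ∃ C, LipschitzOnWith C γ (Icc a b) := by
  obtain ⟨S, hS⟩ := h.piecewise
  exact exists_lipschitzOnWith_of_piecewise S a b h.lt hS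

/-- The derivative is measurable and bounded by the Lipschitz constant at every interior point.
Break points need no separate treatment, since `deriv` is `0` where the curve is not differentiable.
-/
theorem IsPiecewiseC1JordanCurve.intervalIntegrable_deriv {γ : ℝ → ℂ} {a b : ℝ}
    (h : IsPiecewiseC1JordanCurve γ a b) : IntervalIntegrable (deriv γ) volume a b := by
  obtain ⟨C, hC⟩ := h.exists_lipschitzOnWith
  rw [intervalIntegrable_iff_integrableOn_Ioo_of_le h.lt.le]
  refine Measure.integrableOn_of_bounded (M := C) (by simp)
    (measurable_deriv γ).aestronglyMeasurable ?_
  filter_upwards [ae_restrict_mem measurableSet_Ioo] with t ht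
  exact norm_deriv_le_of_lipschitzOn (Icc_mem_nhds ht.1 ht.2) hC

/-- Sampling the parameter with step `ε` covers the thickening by at most `(b - a) / ε + 1` discs of
radius `(1 + C) ε`, of total area `O(ε)`. -/
theorem exists_volume_thickening_image_le {γ : ℝ → ℂ} {a b : ℝ} (hab : a ≤ b) {C : NNReal}
    (hC : LipschitzOnWith C γ (Icc a b)) :
    ∃ K : ℝ, 0 ≤ K ∧ ∀ ε : ℝ, 0 < ε → ε ≤ 1 →
      volume (thickening ε (γ '' Icc a b)) ≤ ENNReal.ofReal (K * ε) := by
  refine ⟨(b - a + 1) * ((1 + C) ^ 2 * Real.pi), by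
    have := sub_nonneg.mpr hab
    positivity, fun ε hε hε1 => ?_⟩
  set N := ⌊(b - a) / ε⌋₊
  have hsub : thickening ε (γ '' Icc a b) ⊆
      ⋃ k ∈ Finset.range (N + 1), ball (γ (a + k * ε)) ((1 + C) * ε) := by
    intro z hz
    obtain ⟨_, ⟨t, ht, rfl⟩, hzt⟩ := mem_thickening_iff.mp hz
    have h0 : 0 ≤ (t - a) / ε := div_nonneg (by linarith [ht.1]) hε.le
    have h1 := Nat.floor_le h0
    have h2 := Nat.lt_floor_add_one ((t - a) / ε)
    set k := ⌊(t - a) / ε⌋₊ with hk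
    rw [le_div_iff₀ hε] at h1
    rw [div_lt_iff₀ hε] at h2
    have hkN : k ≤ N := Nat.floor_mono (by gcongr; exact ht.2)
    simp only [mem_iUnion, Finset.mem_range]
    refine ⟨k, Nat.lt_succ_of_le hkN, mem_ball.mpr ?_⟩
    have h3 := hC.dist_le_mul t ht (a + k * ε)
      ⟨by linarith [mul_nonneg (Nat.cast_nonneg (α := ℝ) k) hε.le], by linarith [ht.2]⟩
    have h4 : dist t (a + k * ε) ≤ ε := by
      rw [Real.dist_eq, abs_le]; constructor <;> linarith
    have h5 : (C : ℝ) * dist t (a + k * ε) ≤ C * ε := mul_le_mul_of_nonneg_left h4 C.2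
    linarith [dist_triangle z (γ t) (γ (a + k * ε))]
  calc volume (thickening ε (γ '' Icc a b))
      ≤ ∑ k ∈ Finset.range (N + 1), volume (ball (γ (a + k * ε)) ((1 + C) * ε)) :=
        (measure_mono hsub).trans (measure_biUnion_finset_le _ _)
    _ = ENNReal.ofReal ((N + 1) * (((1 + C) * ε) ^ 2 * Real.pi)) := by
        simp only [Complex.volume_ball, Finset.sum_const, Finset.card_range, nsmul_eq_mul]
        rw [ENNReal.ofReal_mul (p := (N : ℝ) + 1) (by positivity),
          ENNReal.ofReal_mul (p := ((1 + C) * ε) ^ 2) (by positivity),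
          ENNReal.ofReal_pow (by positivity), ← Nat.cast_add_one, ENNReal.ofReal_natCast,
          ← NNReal.coe_real_pi, ENNReal.ofReal_coe_nnreal]
    _ ≤ _ := by
        refine ENNReal.ofReal_le_ofReal ?_
        have h1 : (N : ℝ) ≤ (b - a) / ε := Nat.floor_le (div_nonneg (by linarith) hε.le)
        rw [le_div_iff₀ hε] at h1
        have h2 : ((N : ℝ) + 1) * ε ≤ b - a + 1 := by linarith
        calc ((N : ℝ) + 1) * (((1 + C) * ε) ^ 2 * Real.pi)
            = (((N : ℝ) + 1) * ε) * ((1 + C) ^ 2 * Real.pi) * ε := by ring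
          _ ≤ _ := by gcongr

/-! ### Area near the frontier and contour integrals through winding numbers -/

namespace IsPiecewiseC1Boundary

variable {D : Set ℂ} {m : ℕ} {γ : Fin m → ℝ → ℂ} {a b : Fin m → ℝ}

theorem mem_frontier (h : IsPiecewiseC1Boundary D γ a b) {i : Fin m} {t : ℝ}
    (ht : t ∈ Icc (a i) (b i)) : γ i t ∈ frontier D := by
  rw [h.frontier_eq]
  exact mem_iUnion.mpr ⟨i, t, ht, rfl⟩

theorem exists_volume_thickening_le (h : IsPiecewiseC1Boundary D γ a b) :
    ∃ K : ℝ, 0 ≤ K ∧ ∀ ε : ℝ, 0 < ε → ε ≤ 1 →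
      volume (thickening ε (frontier D)) ≤ ENNReal.ofReal (K * ε) := by
  have h1 : ∀ i, ∃ K : ℝ, 0 ≤ K ∧ ∀ ε : ℝ, 0 < ε → ε ≤ 1 →
      volume (thickening ε (γ i '' Icc (a i) (b i))) ≤ ENNReal.ofReal (K * ε) := fun i => by
    obtain ⟨C, hC⟩ := (h.jordan i).exists_lipschitzOnWith
    exact exists_volume_thickening_image_le (h.jordan i).lt.le hC
  choose K hK0 hK using h1
  refine ⟨∑ i, K i, Finset.sum_nonneg fun i _ => hK0 i, fun ε hε hε1 => ?_⟩
  rw [h.frontier_eq, thickening_iUnion, Finset.sum_mul,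
    ENNReal.ofReal_sum_of_nonneg fun i _ => mul_nonneg (hK0 i) hε.le]
  exact (measure_iUnion_fintype_le _ _).trans (Finset.sum_le_sum fun i _ => hK i ε hε hε1)

theorem volume_frontier (h : IsPiecewiseC1Boundary D γ a b) : volume (frontier D) = 0 := by
  obtain ⟨K, hK0, hK⟩ := h.exists_volume_thickening_le
  have hlim : Tendsto (fun ε : ℝ => ENNReal.ofReal (K * ε)) (𝓝[>] 0) (𝓝 0) := by
    have : Tendsto (fun ε : ℝ => ENNReal.ofReal (K * ε)) (𝓝 0) (𝓝 (ENNReal.ofReal (K * 0))) :=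
      (ENNReal.continuous_ofReal.comp (continuous_const_mul K)).tendsto 0
    rw [mul_zero, ENNReal.ofReal_zero] at this
    exact this.mono_left nhdsWithin_le_nhds
  refine le_antisymm (ge_of_tendsto hlim ?_) bot_le
  filter_upwards [Ioc_mem_nhdsGT one_pos] with ε hε
  exact (measure_mono (self_subset_thickening hε.1 _)).trans (hK ε hε.1 hε.2)

theorem intervalIntegrable_deriv_div (h : IsPiecewiseC1Boundary D γ a b) (i : Fin m) {z : ℂ}
    (hz : z ∉ frontier D) :
    IntervalIntegrable (fun t => deriv (γ i) t / (γ i t - z)) volume (a i) (b i) := by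
  simp only [div_eq_mul_inv]
  refine (h.jordan i).intervalIntegrable_deriv.mul_continuousOn ?_
  rw [uIcc_of_le (h.jordan i).lt.le]
  refine ContinuousOn.inv₀ ((h.jordan i).continuousOn.sub continuousOn_const) fun t ht h0 => hz ?_
  rw [← sub_eq_zero.mp h0]
  exact h.mem_frontier ht

open Classical in
-- Partial fractions turn the integral into a difference of winding numbers about `w` and `z`. It
-- vanishes for `w` inside `D`; this is the only place where the orientation of the boundary enters.
theorem sum_integral_deriv_div_div (h : IsPiecewiseC1Boundary D γ a b) (hD : IsOpen D) {z w : ℂ}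
    (hz : z ∈ D) (hw : w ∉ frontier D) (hwz : w ≠ z) :
    ∑ i, ∫ t in a i..b i, deriv (γ i) t / (γ i t - z) / (γ i t - w) =
      2 * Real.pi * I * ((if w ∈ D then 1 else 0) - 1) / (w - z) := by
  have hzf : z ∉ frontier D := fun h' => disjoint_left.mp (disjoint_frontier_iff_isOpen.mpr hD) h' hz
  have hpi : (2 * Real.pi * I : ℂ) ≠ 0 := two_pi_I_ne_zero
  have hwz' := sub_ne_zero.mpr hwz
  have hsum : ∀ v, ∑ i, ∫ t in a i..b i, deriv (γ i) t / (γ i t - v) =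
      2 * Real.pi * I * ∑ i, windingNumber (γ i) (a i) (b i) v := fun v => by
    simp only [windingNumber]
    rw [← Finset.mul_sum, mul_inv_cancel_left₀ hpi]
  have h1 : ∀ i, ∫ t in a i..b i, deriv (γ i) t / (γ i t - z) / (γ i t - w) =
      (w - z)⁻¹ * ((∫ t in a i..b i, deriv (γ i) t / (γ i t - w)) -
        ∫ t in a i..b i, deriv (γ i) t / (γ i t - z)) := fun i => by
    rw [← intervalIntegral.integral_sub (h.intervalIntegrable_deriv_div i hw)
      (h.intervalIntegrable_deriv_div i hzf), ← intervalIntegral.integral_const_mul]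
    refine intervalIntegral.integral_congr fun t ht => ?_
    rw [uIcc_of_le (h.jordan i).lt.le] at ht
    have hf := h.mem_frontier ht
    have e1 : γ i t - z ≠ 0 := fun h0 => hzf (sub_eq_zero.mp h0 ▸ hf)
    have e2 : γ i t - w ≠ 0 := fun h0 => hw (sub_eq_zero.mp h0 ▸ hf)
    field_simp
    ring
  simp only [h1]
  rw [← Finset.mul_sum, Finset.sum_sub_distrib, hsum, hsum, h.winding_inside z hz]
  have : ∑ i, windingNumber (γ i) (a i) (b i) w = if w ∈ D then 1 else 0 := by
    split_ifs with hwD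
    · exact h.winding_inside w hwD
    · refine h.winding_outside w fun hc => hw ?_
      rw [frontier, hD.interior_eq]
      exact ⟨hc, hwD⟩
  rw [this]
  field_simp

/-- The Cauchy–Pompeiu formula for test functions on the whole plane. -/
theorem cauchyPompeiu_of_hasCompactSupport (h : IsPiecewiseC1Boundary D γ a b) (hD : IsOpen D)
    {G : ℂ → ℂ} (hG : ContDiff ℝ 1 G) (hs : HasCompactSupport G) {z : ℂ} (hz : z ∈ D) :
    ∑ i, ∫ t in a i..b i, G (γ i t) * (deriv (γ i) t / (γ i t - z)) =
      2 * Real.pi * I * G z + 2 * I * ∫ w in D, wirtinger G w / (w - z) := by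
  classical
  have hzf : z ∉ frontier D := fun h' => disjoint_left.mp (disjoint_frontier_iff_isOpen.mpr hD) h' hz
  have h1 : ∀ i, Integrable (fun w => wirtinger G w *
        ∫ t in Ioc (a i) (b i), deriv (γ i) t / (γ i t - z) / (γ i t - w)) ∧
      ∫ t in Ioc (a i) (b i), G (γ i t) * (deriv (γ i) t / (γ i t - z)) =
        (1 / Real.pi : ℂ) * ∫ w, wirtinger G w *
          ∫ t in Ioc (a i) (b i), deriv (γ i) t / (γ i t - z) / (γ i t - w) := fun i => by
    have hle := (h.jordan i).lt.le
    have hc := (h.jordan i).continuousOn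
    obtain ⟨B, hB⟩ := isCompact_Icc.exists_bound_of_continuousOn hc
    have hp := (intervalIntegrable_iff_integrableOn_Ioc_of_le hle).mp
      (h.intervalIntegrable_deriv_div i hzf)
    exact integral_comp_mul_eq_wirtinger (μ := volume.restrict (Ioc (a i) (b i)))
      ((hc.mono Ioc_subset_Icc_self).aemeasurable measurableSet_Ioc) hp (B := B)
      ((ae_restrict_mem measurableSet_Ioc).mono fun t ht => hB t (Ioc_subset_Icc_self ht)) hG hs
  simp only [← intervalIntegral.integral_of_le (h.jordan _).lt.le] at h1
  simp only [(h1 _).2]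
  rw [← Finset.mul_sum, ← integral_finsetSum _ fun i _ => (h1 i).1]
  -- The contour integral is known off the frontier and away from `z`, hence almost everywhere
  -- because the frontier is a null set. What remains is the integral over `D` minus that over the
  -- plane, and the latter produces `G z`.
  have hae : (fun w => ∑ i, wirtinger G w *
      ∫ t in a i..b i, deriv (γ i) t / (γ i t - z) / (γ i t - w)) =ᵐ[volume]
      fun w => 2 * Real.pi * I * (D.indicator (fun w => wirtinger G w / (w - z)) w -
        wirtinger G w / (w - z)) := by
    have hf := compl_mem_ae_iff.mpr h.volume_frontier
    have hz0 : ∀ᵐ w : ℂ, w ≠ z := by simp [ae_iff]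
    filter_upwards [hf, hz0] with w hw hwz
    rw [← Finset.mul_sum, h.sum_integral_deriv_div_div hD hz hw hwz, indicator]
    split_ifs <;> ring
  obtain ⟨R, M, -, hM, hqM, hqR⟩ := exists_bound_of_hasCompactSupport
    (continuous_wirtinger hG) (hasCompactSupport_wirtinger hs)
  have hint := (integrable_div_sub (continuous_wirtinger hG).aestronglyMeasurable hM hqM hqR z).1
  rw [integral_congr_ae hae, integral_const_mul,
    integral_sub (hint.indicator hD.measurableSet) hint, integral_indicator hD.measurableSet,
    integral_wirtinger_div_sub hG hs]
  have : (Real.pi : ℂ) ≠ 0 := by exact_mod_cast Real.pi_ne_zero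
  field_simp
  ring

end IsPiecewiseC1Boundary

/-! ### Mollification -/

theorem exists_mollifier : ∃ (ρ : ℂ → ℝ) (L : NNReal), ContDiff ℝ 1 ρ ∧ HasCompactSupport ρ ∧
    (∀ v, 0 ≤ ρ v) ∧ (∀ v, 1 ≤ ‖v‖ → ρ v = 0) ∧ ∫ v, ρ v = 1 ∧ LipschitzWith L ρ := by
  let φ : ContDiffBump (0 : ℂ) := ⟨1 / 2, 1, by norm_num, by norm_num⟩
  have hc : ContDiff ℝ 1 (φ.normed volume) := φ.contDiff_normed
  obtain ⟨L, hL⟩ := hc.lipschitzWith_of_hasCompactSupport φ.hasCompactSupport_normed one_ne_zero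
  refine ⟨φ.normed volume, L, hc, φ.hasCompactSupport_normed, φ.nonneg_normed, fun v hv => ?_,
    φ.integral_normed, hL⟩
  have hsup := φ.support_normed_eq (μ := volume)
  by_contra h
  have : v ∈ ball (0 : ℂ) φ.rOut := hsup ▸ (Function.mem_support.mpr h)
  rw [mem_ball_zero_iff] at this
  exact absurd this (not_lt.mpr hv)

/-- The normalization `ε⁻²` reflects the real dimension two of the plane; rescaling the argument
costs another `ε⁻¹` in the Lipschitz constant. -/
theorem exists_scaled_mollifier : ∃ L : ℝ, 0 ≤ L ∧ ∀ ε : ℝ, 0 < ε → ∃ ρ : ℂ → ℝ, ContDiff ℝ 1 ρ ∧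
    HasCompactSupport ρ ∧ (∀ v, 0 ≤ ρ v) ∧ (∀ v, ε ≤ ‖v‖ → ρ v = 0) ∧ ∫ v, ρ v = 1 ∧
    ∀ u v, |ρ u - ρ v| ≤ L / ε ^ 3 * ‖u - v‖ := by
  obtain ⟨ρ, L, h1, h2, h3, h4, h5, h6⟩ := exists_mollifier
  refine ⟨L, L.2, fun ε hε => ⟨fun v => (ε ^ 2)⁻¹ * ρ (ε⁻¹ • v), ?_, ?_, ?_, ?_, ?_, ?_⟩⟩
  · exact contDiff_const.mul (h1.comp (contDiff_const_smul _))
  · exact (h2.comp_smul (inv_ne_zero hε.ne')).mul_left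
  · exact fun v => mul_nonneg (by positivity) (h3 _)
  · intro v hv
    dsimp only
    rw [h4, mul_zero]
    rw [norm_smul, norm_inv, Real.norm_of_nonneg hε.le, inv_mul_eq_div]
    exact (one_le_div hε).mpr hv
  · rw [integral_const_mul, Measure.integral_comp_inv_smul, h5, finrank_real_complex,
      abs_of_pos (by positivity)]
    simp [hε.ne']
  · intro u v
    have := h6.dist_le_mul (ε⁻¹ • u) (ε⁻¹ • v)
    rw [Real.dist_eq, dist_eq_norm, ← smul_sub, norm_smul, norm_inv, Real.norm_of_nonneg hε.le]
      at this
    rw [← mul_sub, abs_mul, abs_of_pos (by positivity)]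
    refine (mul_le_mul_of_nonneg_left this (by positivity)).trans (le_of_eq ?_)
    field_simp

/-- Smoothing at scale `ε` of a continuous function `H`: it approximates `H`, and its derivative is
controlled both by the oscillation of `H` and by the derivative of `H`. -/
theorem exists_mollification : ∃ L : ℝ, 0 ≤ L ∧ ∀ (H : ℂ → ℂ), Continuous H → HasCompactSupport H →
    ∀ ε : ℝ, 0 < ε → ∃ G : ℂ → ℂ, ContDiff ℝ 1 G ∧ HasCompactSupport G ∧
      (∀ w η, (∀ v ∈ ball w ε, ‖H v - H w‖ ≤ η) → ‖G w - H w‖ ≤ η) ∧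
      (∀ w η, 0 ≤ η → (∀ v ∈ ball w (2 * ε), ‖H v - H w‖ ≤ η) →
        ‖fderiv ℝ G w‖ ≤ L * η / ε) ∧
      ∀ w η, 0 ≤ η → ∀ Λ : ℂ →L[ℝ] ℂ, (∀ u ∈ ball w (2 * ε), ∀ v ∈ ball w (2 * ε),
        ‖H u - H v - Λ (u - v)‖ ≤ η * ‖u - v‖) → ‖fderiv ℝ G w - Λ‖ ≤ η := by
  obtain ⟨L, hL, hρ⟩ := exists_scaled_mollifier
  -- The constant is the Lipschitz bound `L / ε³` times the area `4 π ε²` of a disc of radius `2 ε`,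
  -- with the factor `1 / ε` set aside.
  refine ⟨L * (4 * Real.pi), by positivity, fun H hH hHs ε hε => ?_⟩
  obtain ⟨ρ, hρd, hρs, hρ0, hρz, hρi, hρL⟩ := hρ ε hε
  let G : ℂ → ℂ := convolution ρ H (ContinuousLinearMap.lsmul ℝ ℝ) volume
  have hρc := hρd.continuous
  have hGd : ContDiff ℝ 1 G := by
    have := hρs.contDiff_convolution_left (n := 1) (𝕜 := ℝ) (μ := volume)
      (ContinuousLinearMap.lsmul ℝ ℝ) hρd (hH.locallyIntegrable)
    exact_mod_cast this
  have hG1 : ∀ w, G w = ∫ v, ρ v • H (w - v) := fun w => rfl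
  have hG2 : ∀ w, G w = ∫ v, ρ (w - v) • H v := fun w => by
    rw [hG1, ← integral_sub_left_eq_self (fun v => ρ v • H (w - v)) volume w]
    simp
  have hρint : Integrable ρ := hρc.integrable_of_hasCompactSupport hρs
  have hint : ∀ w, Integrable fun v => ρ v • H (w - v) := fun w =>
    (by fun_prop : Continuous fun v => ρ v • H (w - v)).integrable_of_hasCompactSupport
      hρs.smul_right
  have hconst : ∀ c : ℂ, ∫ v, ρ v • c = c := fun c => by
    rw [integral_smul_const, hρi, one_smul]
  have hconsti : ∀ c : ℂ, Integrable fun v => ρ v • c := fun c => hρint.smul_const c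
  refine ⟨G, hGd, HasCompactSupport.convolution _ hρs hHs, fun w η h => ?_, fun w η hη h => ?_,
    fun w η hη Λ h => ?_⟩
  · have e : G w - H w = ∫ v, ρ v • (H (w - v) - H w) := by
      simp only [smul_sub]
      rw [integral_sub (hint w) (hconsti _), hconst, hG1]
    rw [e]
    have hb : ∫ v, ρ v * η = η := by rw [integral_mul_const, hρi, one_mul]
    rw [← hb]
    refine norm_integral_le_of_norm_le (hρint.mul_const η) (Eventually.of_forall fun v => ?_)
    rw [norm_smul, Real.norm_of_nonneg (hρ0 v)]
    rcases lt_or_ge ‖v‖ ε with hv | hv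
    · exact mul_le_mul_of_nonneg_left (h _ (by simpa [dist_eq_norm] using hv)) (hρ0 v)
    · rw [hρz v hv]; simp
  · refine (hGd.differentiable one_ne_zero w).hasFDerivAt.le_of_lip' (by positivity) ?_
    filter_upwards [ball_mem_nhds w hε] with w' hw'
    have hint' : ∀ u, Integrable fun v => ρ (u - v) • H v := fun u => by
      simpa using (hint u).comp_sub_left u
    have hint'' : ∀ u, Integrable fun v => ρ (u - v) • H w := fun u => by
      simpa using (hconsti (H w)).comp_sub_left u
    have hcc : ∀ u, ∫ v, ρ (u - v) • H w = H w := fun u => by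
      rw [integral_sub_left_eq_self (fun v => ρ v • H w) volume u, hconst]
    -- Both translates of `ρ` have integral one, so the constant `H w` can be subtracted and only
    -- the oscillation of `H` counts.
    have e : G w' - G w = ∫ v, (ρ (w' - v) - ρ (w - v)) • (H v - H w) := by
      simp only [sub_smul, smul_sub]
      have i1 : Integrable fun v => ρ (w' - v) • H v - ρ (w - v) • H v := (hint' w').sub (hint' w)
      have i2 : Integrable fun v => ρ (w' - v) • H w - ρ (w - v) • H w :=
        (hint'' w').sub (hint'' w)
      rw [integral_sub i1 i2, integral_sub (hint' w') (hint' w),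
        integral_sub (hint'' w') (hint'' w), hcc, hcc, ← hG2, ← hG2]
      ring
    have hz : ∀ v, v ∉ ball w (2 * ε) → (ρ (w' - v) - ρ (w - v)) • (H v - H w) = 0 := by
      intro v hv
      rw [mem_ball', not_lt, dist_eq_norm] at hv
      rw [mem_ball', dist_eq_norm] at hw'
      have h1 := norm_sub_le_norm_sub_add_norm_sub w w' v
      rw [hρz (w' - v) (by linarith), hρz (w - v) (by linarith), sub_zero, zero_smul]
    rw [e, ← setIntegral_eq_integral_of_forall_compl_eq_zero hz]
    have hv0 : volume.real (ball w (2 * ε)) = 4 * ε ^ 2 * Real.pi := by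
      rw [Measure.real, Complex.volume_ball]
      simp [hε.le]
      ring
    refine (norm_setIntegral_le_of_norm_le_const (C := L / ε ^ 3 * ‖w' - w‖ * η)
      measure_ball_lt_top fun v hv => ?_).trans (le_of_eq ?_)
    · rw [norm_smul, Real.norm_eq_abs]
      have := hρL (w' - v) (w - v)
      rw [sub_sub_sub_cancel_right] at this
      exact mul_le_mul this (h v hv) (norm_nonneg _) (by positivity)
    · rw [hv0]; field_simp
  · have hd := (hGd.differentiable one_ne_zero w).hasFDerivAt.sub Λ.hasFDerivAt
    refine hd.le_of_lip' hη ?_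
    filter_upwards [ball_mem_nhds w hε] with w' hw'
    -- Here the increment falls on `H` instead of `ρ`: an average of increments of `H` inherits
    -- their bound, with no loss in `ε`.
    have e : (G - Λ) w' - (G - Λ) w = ∫ v, ρ v • (H (w' - v) - H (w - v) - Λ (w' - w)) := by
      simp only [smul_sub]
      have i1 : Integrable fun v => ρ v • H (w' - v) - ρ v • H (w - v) := (hint w').sub (hint w)
      rw [integral_sub i1 (hconsti _), integral_sub (hint w') (hint w),
        hconst, ← hG1, ← hG1]
      simp only [Pi.sub_apply, map_sub]
      ring
    rw [e]
    have hb : ∫ v, ρ v * (η * ‖w' - w‖) = η * ‖w' - w‖ := by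
      rw [integral_mul_const, hρi, one_mul]
    rw [← hb]
    refine norm_integral_le_of_norm_le (hρint.mul_const _) (Eventually.of_forall fun v => ?_)
    rw [norm_smul, Real.norm_of_nonneg (hρ0 v)]
    rcases lt_or_ge ‖v‖ ε with hv | hv
    · refine mul_le_mul_of_nonneg_left ?_ (hρ0 v)
      have h1 := h (w' - v) ?_ (w - v) ?_
      · simpa using h1
      · rw [mem_ball, dist_eq_norm] at hw' ⊢
        have := norm_sub_le (w' - w) v
        rw [sub_right_comm] at this
        linarith
      · rw [mem_ball, dist_eq_norm]
        simp only [sub_sub_cancel_left, norm_neg]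
        linarith
    · rw [hρz v hv]; simp

/-! ### The Cauchy–Pompeiu formula for functions of class `C¹` up to the boundary -/

/-- Tietze extension followed by a compactly supported cutoff. Only continuity is extended, which
avoids any `C¹` extension across the boundary. -/
theorem exists_continuous_extension {D : Set ℂ} (hD : Bornology.IsBounded D) {g : ℂ → ℂ}
    (hg : ContinuousOn g (closure D)) :
    ∃ H : ℂ → ℂ, Continuous H ∧ HasCompactSupport H ∧ EqOn H g (closure D) := by
  obtain ⟨f, hf⟩ := ContinuousMap.exists_restrict_eq isClosed_closure
    (⟨(closure D).domRestrict g, continuousOn_iff_continuous_domRestrict.mp hg⟩ : C(closure D, ℂ))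
  obtain ⟨χ, h1, -, h3, -⟩ := exists_continuous_one_zero_of_isCompact hD.isCompact_closure
    isClosed_empty (disjoint_empty _)
  refine ⟨fun w => χ w • f w, by fun_prop, h3.smul_right, fun w hw => ?_⟩
  have : f w = g w := congrArg (fun q => q ⟨w, hw⟩) hf
  simp only [h1 hw, this, Pi.one_apply, one_smul]

/-- The ball is connected, meets `D` and misses its frontier. -/
theorem ball_subset_of_notMem_thickening {D : Set ℂ} (hD : IsOpen D) {w : ℂ} (hw : w ∈ D) {r : ℝ}
    (hr : w ∉ thickening r (frontier D)) : ball w r ⊆ D := by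
  rcases le_or_gt r 0 with hr0 | hr0
  · simp [ball_eq_empty.mpr hr0]
  refine (convex_ball w r).isPreconnected.subset_left_of_subset_union hD
    isClosed_closure.isOpen_compl (disjoint_compl_right.mono_left subset_closure) (fun v hv => ?_)
    ⟨w, mem_ball_self hr0, hw⟩
  by_contra h
  simp only [mem_union, mem_compl_iff, not_or, not_not] at h
  refine hr (mem_thickening_iff.mpr ⟨v, ?_, mem_ball'.mp hv⟩)
  rw [frontier, hD.interior_eq]
  exact ⟨h.2, h.1⟩

namespace IsPiecewiseC1Boundary

variable {D : Set ℂ} {m : ℕ} {γ : Fin m → ℝ → ℂ} {a b : Fin m → ℝ}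

/-- Limit of the formula for mollifications of a continuous extension of `g`. Boundary terms
converge by uniform approximation. The area splits into a strip about the frontier, where small
oscillation beats the factor `1 / ε`, and its complement, where derivatives are bounded by `M` and
converge pointwise. Up to the boundary, a bound on the derivative is enough. -/
theorem cauchyPompeiu (h : IsPiecewiseC1Boundary D γ a b) (hD : IsOpen D)
    (hDb : Bornology.IsBounded D) {g : ℂ → ℂ} (hgc : ContinuousOn g (closure D))
    (hgd : ContDiffOn ℝ 1 g D) {M : ℝ} (hM : ∀ w ∈ D, ‖fderiv ℝ g w‖ ≤ M) {z : ℂ} (hz : z ∈ D) :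
    ∑ i, ∫ t in a i..b i, g (γ i t) * (deriv (γ i) t / (γ i t - z)) =
      2 * Real.pi * I * g z + 2 * I * ∫ w in D, wirtinger g w / (w - z) := by
  have hzf : z ∉ frontier D := fun h' => disjoint_left.mp (disjoint_frontier_iff_isOpen.mpr hD) h' hz
  have hM0 : 0 ≤ M := (norm_nonneg _).trans (hM z hz)
  obtain ⟨H, hHc, hHs, hHg⟩ := exists_continuous_extension hDb hgc
  have hHu : UniformContinuous H := hHs.uniformContinuous_of_continuous hHc
  obtain ⟨L, hL, hmol⟩ := exists_mollification
  obtain ⟨K, hK0, hK⟩ := h.exists_volume_thickening_le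
  set ε : ℕ → ℝ := fun n => 1 / ((n : ℝ) + 1) with hεdef
  have hε0 : ∀ n, 0 < ε n := fun n => by positivity
  have hεlim : Tendsto ε atTop (𝓝 0) := tendsto_one_div_add_atTop_nhds_zero_nat
  have hεlt : ∀ δ : ℝ, 0 < δ → ∀ᶠ n in atTop, 2 * ε n < δ := fun δ hδ => by
    filter_upwards [hεlim.eventually_lt_const (half_pos hδ)] with n hn
    linarith
  choose G hGd hGs hGA hGB hGC using fun n => hmol H hHc hHs (ε n) (hε0 n)
  have hosc : ∀ η : ℝ, 0 < η → ∀ᶠ n in atTop, ∀ w, ∀ v ∈ ball w (2 * ε n), ‖H v - H w‖ ≤ η := by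
    intro η hη
    obtain ⟨δ, hδ, hδH⟩ := Metric.uniformContinuous_iff.mp hHu η hη
    filter_upwards [hεlt δ hδ] with n hn w v hv
    rw [← dist_eq_norm]
    exact (hδH ((mem_ball.mp hv).trans hn)).le
  have hunif : ∀ η : ℝ, 0 < η → ∀ᶠ n in atTop, ∀ w, ‖G n w - H w‖ ≤ η := by
    intro η hη
    filter_upwards [hosc η hη] with n hn w
    exact hGA n w η fun v hv => hn w v (ball_subset_ball (by linarith [hε0 n]) hv)
  have hptw : ∀ w, Tendsto (fun n => G n w) atTop (𝓝 (H w)) := fun w => by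
    refine tendsto_iff_norm_sub_tendsto_zero.mpr (Metric.tendsto_nhds.mpr fun η hη => ?_)
    filter_upwards [hunif (η / 2) (half_pos hη)] with n hn
    rw [Real.dist_0_eq_abs, abs_norm]
    linarith [hn w]
  -- the boundary term
  have hbdry : Tendsto (fun n => ∑ i, ∫ t in a i..b i,
      G n (γ i t) * (deriv (γ i) t / (γ i t - z))) atTop
      (𝓝 (∑ i, ∫ t in a i..b i, g (γ i t) * (deriv (γ i) t / (γ i t - z)))) := by
    refine tendsto_finsetSum _ fun i _ => ?_
    have hle := (h.jordan i).lt.le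
    have heq : ∫ t in a i..b i, g (γ i t) * (deriv (γ i) t / (γ i t - z)) =
        ∫ t in a i..b i, H (γ i t) * (deriv (γ i) t / (γ i t - z)) := by
      refine intervalIntegral.integral_congr fun t ht => ?_
      rw [uIcc_of_le hle] at ht
      simp only [hHg (frontier_subset_closure (h.mem_frontier ht))]
    rw [heq]
    have hp := h.intervalIntegrable_deriv_div i hzf
    obtain ⟨B, hB⟩ := hHc.bounded_above_of_compact_support hHs
    refine intervalIntegral.tendsto_integral_filter_of_dominated_convergence
      (fun t => (B + 1) * ‖deriv (γ i) t / (γ i t - z)‖) ?_ ?_ (hp.norm.const_mul _) ?_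
    · refine Eventually.of_forall fun n => ?_
      rw [uIoc_of_le hle]
      refine AEStronglyMeasurable.mul ?_ (hp.1.1)
      exact (((hGd n).continuous.comp_continuousOn (h.jordan i).continuousOn).mono
        Ioc_subset_Icc_self).aestronglyMeasurable measurableSet_Ioc
    · filter_upwards [hunif 1 one_pos] with n hn
      refine Eventually.of_forall fun t _ => ?_
      rw [norm_mul]
      refine mul_le_mul_of_nonneg_right ?_ (norm_nonneg _)
      have h1 := norm_sub_norm_le (G n (γ i t)) (H (γ i t))
      linarith [hn (γ i t), hB (γ i t)]
    · exact Eventually.of_forall fun t _ => (hptw _).mul_const _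
  -- the area term
  set S : ℕ → Set ℂ := fun n => thickening (2 * ε n) (frontier D) with hS
  have hSm : ∀ n, MeasurableSet (S n) := fun n => isOpen_thickening.measurableSet
  obtain ⟨R, hR0, hR⟩ := hDb.subset_ball_lt 0 0
  have hDfin : volume D ≠ ⊤ := ((measure_mono hR).trans_lt measure_ball_lt_top).ne
  have hint : ∀ n, IntegrableOn (fun w => wirtinger (G n) w / (w - z)) D := fun n => by
    obtain ⟨R, M, -, hM, hqM, hqR⟩ := exists_bound_of_hasCompactSupport
      (continuous_wirtinger (hGd n)) (hasCompactSupport_wirtinger (hGs n))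
    exact (integrable_div_sub (continuous_wirtinger (hGd n)).aestronglyMeasurable hM hqM hqR
      z).1.integrableOn
  have hstrip : Tendsto (fun n => ∫ w in D ∩ S n, wirtinger (G n) w / (w - z)) atTop (𝓝 0) := by
    obtain ⟨δ, hδ, hδD⟩ := Metric.isOpen_iff.mp hD z hz
    refine Metric.tendsto_nhds.mpr fun η hη => ?_
    -- The summand `1` keeps `c` positive even if `L` or `K` vanishes; oscillation `η / (2 c)` then
    -- leaves at most `η / 2`.
    set c : ℝ := L * (2 / δ) * (2 * K) + 1 with hc
    have hc0 : 0 < c := by positivity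
    filter_upwards [hosc (η / (2 * c)) (by positivity), hεlt 1 one_pos,
      hεlt (δ / 2) (half_pos hδ)] with n h1 h2 h3
    rw [dist_zero_right]
    have hvol : volume (D ∩ S n) ≤ ENNReal.ofReal (K * (2 * ε n)) :=
      (measure_mono inter_subset_right).trans (hK _ (by linarith [hε0 n]) h2.le)
    have hvr : volume.real (D ∩ S n) ≤ K * (2 * ε n) :=
      ENNReal.toReal_le_of_le_ofReal (mul_nonneg hK0 (by linarith [hε0 n])) hvol
    have hb := norm_setIntegral_le_of_norm_le_const (μ := volume)
      (f := fun w => wirtinger (G n) w / (w - z)) (C := L * (η / (2 * c)) / ε n * (2 / δ))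
      (hvol.trans_lt ENNReal.ofReal_lt_top) fun w hw => ?_
    · refine hb.trans_lt ?_
      have hεn := hε0 n
      calc L * (η / (2 * c)) / ε n * (2 / δ) * volume.real (D ∩ S n)
          ≤ L * (η / (2 * c)) / ε n * (2 / δ) * (K * (2 * ε n)) := by gcongr
        _ = (L * (2 / δ) * (2 * K)) * (η / (2 * c)) := by field_simp
        _ ≤ c * (η / (2 * c)) := by gcongr; linarith
        _ < η := by field_simp; linarith
    · rw [norm_div, div_eq_mul_inv]
      refine mul_le_mul ((norm_wirtinger_le _ _).trans
        (hGB n w _ (by positivity) (h1 w))) ?_ (by positivity)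
        (by have := hε0 n; positivity)
      -- The frontier has distance at least `δ` from `z` and the strip is narrower than `δ / 2`, so
      -- the kernel is at most `2 / δ` there.
      obtain ⟨v, hv, hwv⟩ := mem_thickening_iff.mp hw.2
      have hvz : δ ≤ dist v z := by
        by_contra hlt
        exact disjoint_left.mp (disjoint_frontier_iff_isOpen.mpr hD) hv (hδD (not_le.mp hlt))
      have : δ / 2 ≤ ‖w - z‖ := by
        rw [← dist_eq_norm]
        linarith [dist_triangle v w z, dist_comm v w]
      rw [← inv_div]
      exact inv_anti₀ (by positivity) this
  have hfar : Tendsto (fun n => ∫ w in D \ S n, wirtinger (G n) w / (w - z)) atTop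
      (𝓝 (∫ w in D, wirtinger g w / (w - z))) := by
    have e : ∀ n, ∫ w in D \ S n, wirtinger (G n) w / (w - z) =
        ∫ w in D, (S n)ᶜ.indicator (fun w => wirtinger (G n) w / (w - z)) w := fun n => by
      rw [setIntegral_indicator (hSm n).compl, sdiff_eq]
    simp only [e]
    refine tendsto_integral_of_dominated_convergence (fun w => M * ‖w - z‖⁻¹) (fun n => ?_)
      (((integrableOn_inv_norm_sub R z).1.mono_set hR).const_mul M) (fun n => ?_) ?_
    · exact (hint n).1.indicator (hSm n).compl
    · filter_upwards [ae_restrict_mem hD.measurableSet] with w hw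
      by_cases hwS : w ∈ S n
      · rw [indicator_of_notMem (by simpa using hwS), norm_zero]; positivity
      rw [indicator_of_mem (by simpa using hwS), norm_div, div_eq_mul_inv]
      refine mul_le_mul_of_nonneg_right ((norm_wirtinger_le _ _).trans ?_) (by positivity)
      have hball := ball_subset_of_notMem_thickening hD hw hwS
      -- With `Λ = 0` the estimate says that mollifying preserves the Lipschitz bound `M`, valid on
      -- the disc because it lies in `D`.
      have := hGC n w M hM0 0 fun u hu v hv => ?_
      · simpa using this
      · rw [hHg (subset_closure (hball hu)), hHg (subset_closure (hball hv))]
        simpa using (convex_ball w (2 * ε n)).norm_image_sub_le_of_norm_fderiv_le (𝕜 := ℝ)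
          (fun x hx => (hgd.differentiableOn one_ne_zero).differentiableAt
            (hD.mem_nhds (hball hx))) (fun x hx => hM x (hball hx)) hv hu
    · filter_upwards [ae_restrict_mem hD.measurableSet] with w hw
      have hcont : ContinuousAt (fderiv ℝ g) w :=
        (hgd.continuousOn_fderiv_of_isOpen hD le_rfl).continuousAt (hD.mem_nhds hw)
      have hder : Tendsto (fun n => fderiv ℝ (G n) w) atTop (𝓝 (fderiv ℝ g w)) := by
        refine tendsto_iff_norm_sub_tendsto_zero.mpr (Metric.tendsto_nhds.mpr fun η hη => ?_)
        obtain ⟨r, hr, hrη⟩ := Metric.eventually_nhds_iff_ball.mp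
          ((Metric.continuousAt_iff'.mp hcont (η / 2) (half_pos hη)).and (hD.mem_nhds hw))
        filter_upwards [hεlt r hr] with n hn
        rw [Real.dist_0_eq_abs, abs_norm]
        refine (hGC n w (η / 2) (half_pos hη).le (fderiv ℝ g w) fun u hu v hv => ?_).trans_lt
          (half_lt_self hη)
        have hu' := ball_subset_ball hn.le hu
        have hv' := ball_subset_ball hn.le hv
        rw [hHg (subset_closure (hrη u hu').2), hHg (subset_closure (hrη v hv').2)]
        exact (convex_ball w r).norm_image_sub_le_of_norm_fderiv_le' (𝕜 := ℝ)
          (fun x hx => (hgd.differentiableOn one_ne_zero).differentiableAt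
            (hD.mem_nhds (hrη x hx).2))
          (fun x hx => (dist_eq_norm (fderiv ℝ g x) _ ▸ (hrη x hx).1.le)) hv' hu'
      have hwir : Tendsto (fun n => wirtinger (G n) w / (w - z)) atTop
          (𝓝 (wirtinger g w / (w - z))) := by
        have h1 := ((ContinuousLinearMap.apply ℝ ℂ (1 : ℂ)).continuous.tendsto _).comp hder
        have h2 := ((ContinuousLinearMap.apply ℝ ℂ I).continuous.tendsto _).comp hder
        exact ((h1.add (h2.const_mul I)).const_mul (1 / 2 : ℂ)).div_const (w - z)
      refine hwir.congr' ?_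
      obtain ⟨r, hr, hrD⟩ := Metric.isOpen_iff.mp hD w hw
      filter_upwards [hεlt r hr] with n hn
      rw [indicator_of_mem]
      intro hwS
      obtain ⟨v, hv, hwv⟩ := mem_thickening_iff.mp hwS
      exact disjoint_left.mp (disjoint_frontier_iff_isOpen.mpr hD) hv
        (hrD (mem_ball'.mpr (hwv.trans hn)))
  have harea : Tendsto (fun n => ∫ w in D, wirtinger (G n) w / (w - z)) atTop
      (𝓝 (∫ w in D, wirtinger g w / (w - z))) := by
    have := hstrip.add hfar
    rw [zero_add] at this
    refine this.congr fun n => ?_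
    exact integral_inter_add_sdiff (hSm n) (hint n)
  have hG := fun n => h.cauchyPompeiu_of_hasCompactSupport hD (hGd n) (hGs n) hz
  refine tendsto_nhds_unique hbdry ?_
  simp only [hG]
  have hHz : H z = g z := hHg (subset_closure hz)
  rw [← hHz]
  exact ((hptw z).const_mul _).add (harea.const_mul _)

end IsPiecewiseC1Boundary

/-! ### The complex structure defined by an imaginary unit -/

section LeftAction

theorem mul_mul_of_sq_eq_neg_one {A : Type*} [NonAssocRing A] [IsAlternative A] {J : A}
    (hJ : J * J = -1) (a : A) : J * (J * a) = -a := by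
  have h := IsAlternative.associator_left J a
  rw [associator_apply, sub_eq_zero, hJ, neg_mul, one_mul] at h
  exact h.symm

variable {A : Type*} [NormedNonAssocRing A] [NormedSpace ℝ A]

/-- The map `φ_J` as a continuous linear map. -/
noncomputable def phiCLM (J : A) : ℂ →L[ℝ] A :=
  reCLM.smulRight (1 : A) + imCLM.smulRight J

namespace IsC1OnClosure

variable {D : Set ℂ} {g g' : ℂ → A}

theorem exists_bound (h : IsC1OnClosure D g) (hDb : Bornology.IsBounded D) :
    ∃ M, ∀ z ∈ D, ‖fderiv ℝ g z‖ ≤ M := by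
  obtain ⟨G', hc, hG'⟩ := h.deriv_extends
  obtain ⟨M, hM⟩ := hDb.isCompact_closure.exists_bound_of_continuousOn hc
  exact ⟨M, fun z hz => hG' z hz ▸ hM z (subset_closure hz)⟩

theorem differentiableAt (h : IsC1OnClosure D g) (hD : IsOpen D) {z : ℂ} (hz : z ∈ D) :
    DifferentiableAt ℝ g z :=
  (h.contDiffOn.differentiableOn one_ne_zero).differentiableAt (hD.mem_nhds hz)

theorem add_clm_comp (h : IsC1OnClosure D g) (h' : IsC1OnClosure D g') (hD : IsOpen D)
    (T : A →L[ℝ] A) : IsC1OnClosure D (fun z => g z + T (g' z)) := by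
  obtain ⟨G, hc, hG⟩ := h.deriv_extends
  obtain ⟨G', hc', hG'⟩ := h'.deriv_extends
  refine ⟨h.contDiffOn.add (T.contDiff.comp_contDiffOn h'.contDiffOn),
    h.continuousOn.add (T.continuous.comp_continuousOn h'.continuousOn),
    fun z => G z + T.comp (G' z), hc.add (continuousOn_const.clm_comp hc'), fun z hz => ?_⟩
  have h1 := (h.differentiableAt hD hz).hasFDerivAt
  have h2 := T.hasFDerivAt.comp z (h'.differentiableAt hD hz).hasFDerivAt
  dsimp only
  rw [hG z hz, hG' z hz]
  exact ((h1.add h2).fderiv).symm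

end IsC1OnClosure

variable [SMulCommClass ℝ A A]

theorem phi_mul {A : Type*} [NormedNonAssocRing A] [NormedSpace ℝ A] [IsScalarTower ℝ A A] (J : A)
    (z : ℂ) (a : A) : phi J z * a = z.re • a + z.im • (J * a) := by
  simp [phi, add_mul, smul_mul_assoc]

theorem neg_mul_phi {J : A} (hJ : J * J = -1) (w : ℂ) : -J * phi J w = phi J (-I * w) := by
  have h1 : (-I * w).re = w.im := by simp
  have h2 : (-I * w).im = -w.re := by simp
  rw [phi, phi, h1, h2]
  simp only [mul_add, mul_smul_comm, neg_mul, mul_one, hJ, neg_neg]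
  module

/-- This is the one associativity law that the argument needs: the plane of `J` acts on `A` from the
left as the field of complex numbers. -/
theorem phi_mul_phi_mul [IsScalarTower ℝ A A] [IsAlternative A] {J : A} (hJ : J * J = -1) (z w : ℂ) (a : A) :
    phi J z * (phi J w * a) = phi J (z * w) * a := by
  simp only [phi_mul, mul_add, mul_smul_comm, mul_mul_of_sq_eq_neg_one hJ, mul_re, mul_im]
  module

variable [FiniteDimensional ℝ A]

/-- Left multiplication by `J`, as a continuous linear map. -/
noncomputable def mulLeftCLM (J : A) : A →L[ℝ] A :=
  (LinearMap.mulLeft ℝ J).toContinuousLinearMap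

@[simp] theorem mulLeftCLM_apply (J a : A) : mulLeftCLM J a = J * a := rfl

/-- The complex coordinate of `(A, J)` with real part `ℓ`. -/
noncomputable def complexify (J : A) (ℓ : A →L[ℝ] ℝ) : A →L[ℝ] ℂ :=
  (ofRealCLM.comp ℓ) - I • (ofRealCLM.comp (ℓ.comp (mulLeftCLM J)))

theorem complexify_apply (J : A) (ℓ : A →L[ℝ] ℝ) (a : A) :
    complexify J ℓ a = ℓ a - I * ℓ (J * a) := rfl

theorem eq_of_forall_complexify_eq (J : A) {u v : A}
    (h : ∀ ℓ : A →L[ℝ] ℝ, complexify J ℓ u = complexify J ℓ v) : u = v := by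
  refine (SeparatingDual.eq_iff_forall_dual_eq (R := ℝ)).mpr fun ℓ => ?_
  have := congrArg Complex.re (h ℓ)
  simpa [complexify_apply] using this

variable [IsScalarTower ℝ A A]

theorem integrable_phi_mul {T : Type*} [MeasurableSpace T] {μ : Measure T} (J : A) {k : T → ℂ}
    {u : T → A} (hk : Integrable k μ) (hu : AEStronglyMeasurable u μ) {B : ℝ}
    (hB : ∀ᵐ t ∂μ, ‖u t‖ ≤ B) : Integrable (fun t => phi J (k t) * u t) μ := by
  simp only [phi_mul]
  have hJu : AEStronglyMeasurable (fun t => J * u t) μ :=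
    (mulLeftCLM J).continuous.comp_aestronglyMeasurable hu
  refine (hk.re.smul_bdd B hu hB).add
    (hk.im.smul_bdd (‖mulLeftCLM J‖ * B) hJu ?_)
  filter_upwards [hB] with t ht
  exact ((mulLeftCLM J).le_opNorm (u t)).trans (by gcongr)

/-- Subtracting `I * ℓ (J * a)` makes the real functional complex linear for the structure given by
`J`. Such functionals separate points, so scalar identities lift to `A`. -/
theorem complexify_phi_mul [IsAlternative A] {J : A} (hJ : J * J = -1) (ℓ : A →L[ℝ] ℝ) (z : ℂ)
    (a : A) : complexify J ℓ (phi J z * a) = z * complexify J ℓ a := by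
  simp only [phi_mul, map_add, map_smul, complexify_apply, mul_mul_of_sq_eq_neg_one hJ, map_neg,
    real_smul, ofReal_neg]
  have hz := re_add_im z
  set x : ℂ := (z.re : ℂ)
  set y : ℂ := (z.im : ℂ)
  rw [← hz]
  linear_combination (y * ℓ (J * a)) * I_sq

/-- The Wirtinger derivative `∂g/∂z̄` with respect to the complex structure of `(A, J)`. -/
noncomputable def leftWirtinger (J : A) (g : ℂ → A) (w : ℂ) : A :=
  (1 / 2 : ℝ) • (fderiv ℝ g w 1 + J * fderiv ℝ g w I)

namespace IsPiecewiseC1Boundary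

variable {D : Set ℂ} {m : ℕ} {γ : Fin m → ℝ → ℂ} {a b : Fin m → ℝ}

theorem intervalIntegrable_phi_mul (h : IsPiecewiseC1Boundary D γ a b) (hD : IsOpen D)
    {g : ℂ → A} (hg : ContinuousOn g (closure D)) (J : A) {z : ℂ} (hz : z ∈ D) (i : Fin m) :
    IntervalIntegrable (fun t => phi J (-I * (deriv (γ i) t / (γ i t - z))) * g (γ i t))
      volume (a i) (b i) := by
  have hle := (h.jordan i).lt.le
  have hzf : z ∉ frontier D := fun h' => disjoint_left.mp (disjoint_frontier_iff_isOpen.mpr hD) h' hz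
  have hc : ContinuousOn (fun t => g (γ i t)) (Icc (a i) (b i)) :=
    hg.comp (h.jordan i).continuousOn fun t ht => frontier_subset_closure (h.mem_frontier ht)
  obtain ⟨B, hB⟩ := isCompact_Icc.exists_bound_of_continuousOn hc
  rw [intervalIntegrable_iff_integrableOn_Ioc_of_le hle]
  exact integrable_phi_mul J (((intervalIntegrable_iff_integrableOn_Ioc_of_le hle).mp
      (h.intervalIntegrable_deriv_div i hzf)).const_mul (-I))
    ((hc.mono Ioc_subset_Icc_self).aestronglyMeasurable measurableSet_Ioc)
    ((ae_restrict_mem measurableSet_Ioc).mono fun t ht => hB t (Ioc_subset_Icc_self ht))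

end IsPiecewiseC1Boundary

theorem integrableOn_phi_mul_leftWirtinger {D : Set ℂ} (hD : IsOpen D)
    (hDb : Bornology.IsBounded D) {g : ℂ → A} (hg : IsC1OnClosure D g) (J : A) (z : ℂ) :
    IntegrableOn (fun w => phi J (w - z)⁻¹ * leftWirtinger J g w) D := by
  obtain ⟨R, -, hR⟩ := hDb.subset_ball_lt 0 0
  obtain ⟨M, hM⟩ := hg.exists_bound hDb
  have hk : IntegrableOn (fun w : ℂ => (w - z)⁻¹) D := by
    refine ((integrableOn_inv_norm_sub R z).1.mono_set hR).mono' ?_ ?_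
    · exact (by fun_prop : Measurable fun w : ℂ => (w - z)⁻¹).aestronglyMeasurable
    · exact Eventually.of_forall fun w => (norm_inv _).le
  have hf : ContinuousOn (fderiv ℝ g) D := hg.contDiffOn.continuousOn_fderiv_of_isOpen hD le_rfl
  have hw : ContinuousOn (leftWirtinger J g) D :=
    ((hf.clm_apply continuousOn_const).add ((mulLeftCLM J).continuous.comp_continuousOn
      (hf.clm_apply continuousOn_const))).const_smul _
  refine integrable_phi_mul J hk (hw.aestronglyMeasurable hD.measurableSet)
    (B := 1 / 2 * (M + ‖mulLeftCLM J‖ * M)) ?_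
  filter_upwards [ae_restrict_mem hD.measurableSet] with w hwD
  have h1 := ((fderiv ℝ g w).le_opNorm 1).trans_eq (by rw [norm_one, mul_one])
  have h2 := ((fderiv ℝ g w).le_opNorm I).trans_eq (by rw [norm_I, mul_one])
  have h3 := (mulLeftCLM J).le_opNorm (fderiv ℝ g w I)
  have h4 := norm_add_le (fderiv ℝ g w 1) (J * fderiv ℝ g w I)
  have h5 := hM w hwD
  have h6 := mul_le_mul_of_nonneg_left (h2.trans h5) (norm_nonneg (mulLeftCLM J))
  rw [mulLeftCLM_apply] at h3
  rw [leftWirtinger, norm_smul, Real.norm_of_nonneg (by norm_num)]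
  gcongr
  linarith

/-- The Cauchy–Pompeiu formula in `A`, for the complex structure given by left multiplication
by `J`. -/
theorem IsPiecewiseC1Boundary.leftCauchyPompeiu [IsAlternative A] {D : Set ℂ} {m : ℕ}
    {γ : Fin m → ℝ → ℂ} {a b : Fin m → ℝ} (h : IsPiecewiseC1Boundary D γ a b) (hD : IsOpen D)
    (hDb : Bornology.IsBounded D) {g : ℂ → A} (hg : IsC1OnClosure D g) {J : A} (hJ : J * J = -1)
    {z : ℂ} (hz : z ∈ D) :
    g z = (1 / (2 * Real.pi)) • (∑ i, ∫ t in a i..b i,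
        phi J (-I * (deriv (γ i) t / (γ i t - z))) * g (γ i t)) -
      (1 / (2 * Real.pi)) • ((2 : ℝ) • ∫ w in D, phi J (w - z)⁻¹ * leftWirtinger J g w) := by
  refine eq_of_forall_complexify_eq J fun ℓ => ?_
  set lam := complexify J ℓ with hlam
  obtain ⟨M, hM⟩ := hg.exists_bound hDb
  have hfd : ∀ w ∈ D, fderiv ℝ (fun w => lam (g w)) w = lam.comp (fderiv ℝ g w) := fun w hw =>
    (lam.hasFDerivAt.comp w (hg.differentiableAt hD hw).hasFDerivAt).fderiv
  have key := h.cauchyPompeiu hD hDb (g := fun w => lam (g w))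
    (lam.continuous.comp_continuousOn hg.continuousOn) (lam.contDiff.comp_contDiffOn hg.contDiffOn)
    (M := ‖lam‖ * M) (fun w hw => by
      rw [hfd w hw]
      exact (lam.opNorm_comp_le _).trans (by gcongr; exact hM w hw)) hz
  have hB : ∀ i, lam (∫ t in a i..b i, phi J (-I * (deriv (γ i) t / (γ i t - z))) * g (γ i t)) =
      -I * ∫ t in a i..b i, lam (g (γ i t)) * (deriv (γ i) t / (γ i t - z)) := fun i => by
    rw [← lam.intervalIntegral_comp_comm (h.intervalIntegrable_phi_mul hD hg.continuousOn J hz i),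
      ← intervalIntegral.integral_const_mul]
    refine intervalIntegral.integral_congr fun t _ => ?_
    simp only [hlam]
    rw [complexify_phi_mul hJ]
    ring
  have hAr : lam (∫ w in D, phi J (w - z)⁻¹ * leftWirtinger J g w) =
      ∫ w in D, wirtinger (fun w => lam (g w)) w / (w - z) := by
    rw [← lam.integral_comp_comm (integrableOn_phi_mul_leftWirtinger hD hDb hg J z)]
    refine setIntegral_congr_fun hD.measurableSet fun w hw => ?_
    have hJm : ∀ a, lam (J * a) = I * lam a := fun a => by
      have := complexify_phi_mul hJ ℓ I a
      simpa [phi] using this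
    simp only [hlam]
    rw [complexify_phi_mul hJ, ← hlam, wirtinger, hfd w hw, leftWirtinger, map_smul, map_add, hJm]
    simp only [ContinuousLinearMap.comp_apply, real_smul]
    push_cast
    ring
  rw [map_sub, map_smul, map_smul, map_smul, map_sum, hAr]
  simp only [hB]
  rw [← Finset.mul_sum, key]
  simp only [real_smul]
  have hpi : (Real.pi : ℂ) ≠ 0 := by exact_mod_cast Real.pi_ne_zero
  push_cast
  field_simp
  linear_combination (Real.pi * lam (g z) +
    ∫ w in D, wirtinger (fun w => lam (g w)) w / (w - z)) * I_sq

end LeftAction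

/-! ### Stem functions and the Cauchy kernel -/

section Stem

variable {A : Type*} [NormedNonAssocRing A] [NormedSpace ℝ A]

theorem isStem_closure {A : Type*} [NormedNonAssocRing A] {D : Set ℂ} {F : ℂ → Complexification A} (hF : IsStem D F)
    (hD : ∀ z ∈ D, starRingEnd ℂ z ∈ D) (hre : ContinuousOn (fun z => (F z).re) (closure D))
    (him : ContinuousOn (fun z => (F z).im) (closure D)) : IsStem (closure D) F := by
  have hmaps : MapsTo (starRingEnd ℂ) (closure D) (closure D) :=
    MapsTo.closure (fun z hz => hD z hz) continuous_conj
  have h1 : EqOn (fun z => (F (starRingEnd ℂ z)).re) (fun z => (F z).re) (closure D) :=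
    EqOn.of_subset_closure (fun z hz => by
      have h := congrArg Complexification.re (hF z hz); exact h)
      (hre.comp continuous_conj.continuousOn hmaps) hre subset_closure le_rfl
  have h2 : EqOn (fun z => (F (starRingEnd ℂ z)).im) (fun z => -(F z).im) (closure D) :=
    EqOn.of_subset_closure (fun z hz => congrArg Complexification.im (hF z hz))
      (him.comp continuous_conj.continuousOn hmaps) him.neg subset_closure le_rfl
  exact fun z hz => Complexification.ext (h1 hz) (h2 hz)

theorem fderiv_conj_of_eventuallyEq {f f' : ℂ → A} {z : ℂ}
    (hf : DifferentiableAt ℝ f (starRingEnd ℂ z))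
    (h : (fun w => f (starRingEnd ℂ w)) =ᶠ[𝓝 z] f') :
    fderiv ℝ f (starRingEnd ℂ z) 1 = fderiv ℝ f' z 1 ∧
      fderiv ℝ f (starRingEnd ℂ z) I = -fderiv ℝ f' z I := by
  have h1 : HasFDerivAt (fun w => f (starRingEnd ℂ w))
      ((fderiv ℝ f (starRingEnd ℂ z)).comp (conjCLE : ℂ →L[ℝ] ℂ)) z :=
    hf.hasFDerivAt.comp z conjCLE.hasFDerivAt
  rw [← h.fderiv_eq, h1.fderiv]
  simp

/-- Under conjugation `F₁` is even and `F₂` odd, and `∂/∂s` changes sign; the parities of the two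
components are thus preserved. This makes the slice derivative computable on any chosen slice. -/
theorem isStem_dbarStem {D : Set ℂ} {F : ℂ → Complexification A} (hF : IsStem D F)
    (hDo : IsOpen D) (hD : ∀ z ∈ D, starRingEnd ℂ z ∈ D)
    (hre : IsC1OnClosure D (fun z => (F z).re)) (him : IsC1OnClosure D (fun z => (F z).im)) :
    IsStem D (dbarStem F) := by
  intro z hz
  obtain ⟨h1, h2⟩ := fderiv_conj_of_eventuallyEq (f' := fun z => (F z).re)
    (hre.differentiableAt hDo (hD z hz))
    (eventually_of_mem (hDo.mem_nhds hz) fun w hw => by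
      have h := congrArg Complexification.re (hF w hw); exact h)
  obtain ⟨h3, h4⟩ := fderiv_conj_of_eventuallyEq (f' := fun z => -(F z).im)
    (him.differentiableAt hDo (hD z hz))
    (eventually_of_mem (hDo.mem_nhds hz) fun w hw => congrArg Complexification.im (hF w hw))
  have h5 : fderiv ℝ (fun z => -(F z).im) z = -fderiv ℝ (fun z => (F z).im) z := fderiv_neg
  rw [h5, neg_apply] at h3 h4
  ext
  · simp only [SliceCauchy.dbarStem, Complexification.conj, h1, h4, neg_neg]
  · simp only [SliceCauchy.dbarStem, Complexification.conj, h2, h3, ← smul_neg, neg_add]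

theorem dbarStem_re_add_mul_im [FiniteDimensional ℝ A] [IsScalarTower ℝ A A] [SMulCommClass ℝ A A]
    [IsAlternative A] {F : ℂ → Complexification A} {J : A} (hJ : J * J = -1) {z : ℂ}
    (hre : DifferentiableAt ℝ (fun z => (F z).re) z)
    (him : DifferentiableAt ℝ (fun z => (F z).im) z) :
    (dbarStem F z).re + J * (dbarStem F z).im =
      leftWirtinger J (fun z => (F z).re + J * (F z).im) z := by
  have h : HasFDerivAt (fun z => (F z).re + J * (F z).im)
      (fderiv ℝ (fun z => (F z).re) z + (mulLeftCLM J).comp (fderiv ℝ (fun z => (F z).im) z)) z :=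
    hre.hasFDerivAt.add ((mulLeftCLM J).hasFDerivAt.comp z him.hasFDerivAt)
  rw [leftWirtinger, h.fderiv, dbarStem]
  simp only [add_apply, ContinuousLinearMap.comp_apply, mulLeftCLM_apply,
    mul_add, mul_smul_comm, mul_mul_of_sq_eq_neg_one hJ]
  module

theorem toReal_smul_one [Nontrivial A] (r : ℝ) : toReal (r • (1 : A)) = r := by
  have h : ∃ s : ℝ, r • (1 : A) = s • (1 : A) := ⟨r, rfl⟩
  rw [toReal, dif_pos h]
  exact (smul_left_injective ℝ (one_ne_zero (α := A)) h.choose_spec).symm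

/-! ### Values on the slice of `K` from two values on the slice of `J` -/

section Representation

variable [FiniteDimensional ℝ A] [SMulCommClass ℝ A A]

/-- The combination `½ (1 - K J) u + ½ (1 + K J) v` of the representation formula. -/
noncomputable def representation (J K : A) : (A →L[ℝ] A) × (A →L[ℝ] A) :=
  ((1 / 2 : ℝ) • (ContinuousLinearMap.id ℝ A - (mulLeftCLM K).comp (mulLeftCLM J)),
    (1 / 2 : ℝ) • (ContinuousLinearMap.id ℝ A + (mulLeftCLM K).comp (mulLeftCLM J)))

theorem representation_fst_apply (J K u : A) :
    (representation J K).1 u = (1 / 2 : ℝ) • (u - K * (J * u)) := rfl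

theorem representation_snd_apply (J K u : A) :
    (representation J K).2 u = (1 / 2 : ℝ) • (u + K * (J * u)) := rfl

/-- With `u = F₁ + J F₂` and `v = F₁ - J F₂`, half the sum is `F₁` and half of `J v - J u` is `F₂`.
Multiplication by `K` comes last, so `K` and `J` never need to associate. -/
theorem re_add_mul_im_eq_representation [IsAlternative A] {J K : A}
    (hJ : J * J = -1) {D : Set ℂ} {F : ℂ → Complexification A} (hF : IsStem D F) {z : ℂ}
    (hz : z ∈ D) :
    (F z).re + K * (F z).im = (representation J K).1 ((F z).re + J * (F z).im) +
      (representation J K).2 ((F (starRingEnd ℂ z)).re + J * (F (starRingEnd ℂ z)).im) := by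
  rw [hF z hz]
  simp only [representation_fst_apply, representation_snd_apply, Complexification.conj, mul_add,
    mul_neg, mul_mul_of_sq_eq_neg_one hJ]
  module

end Representation

/-! ### The Cauchy kernel on a slice -/

variable [StarRing A]

theorem cauchyKernelStem_mul_constStem [IsScalarTower ℝ A A] {y c : A} {z d : ℂ}
    (hd : (z ^ 2 - z * (trace y : ℂ) + (sqNorm y : ℂ))⁻¹ = d) :
    cauchyKernelStem y z * constStem c z =
      ⟨d.re • (star y * c - z.re • c) + (d.im * z.im) • c,
        d.im • (star y * c - z.re • c) - (d.re * z.im) • c⟩ := by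
  rw [cauchyKernelStem, hd]
  refine Complexification.ext ?_ ?_
  · change (d.re • (star y - z.re • (1 : A)) - d.im • (-(z.im • (1 : A)))) * c -
      (d.re • (-(z.im • (1 : A))) + d.im • (star y - z.re • (1 : A))) * 0 = _
    simp only [mul_zero, sub_zero, sub_mul, smul_mul_assoc, neg_mul, one_mul]
    module
  · change (d.re • (star y - z.re • (1 : A)) - d.im • (-(z.im • (1 : A)))) * 0 +
      (d.re • (-(z.im • (1 : A))) + d.im • (star y - z.re • (1 : A))) * c = _
    simp only [mul_zero, zero_add, add_mul, sub_mul, smul_mul_assoc, neg_mul, one_mul]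
    module

/-- The denominator has real coefficients, so it commutes with conjugation. The convention `0⁻¹ = 0`
respects this, so no point need be excluded. -/
theorem isStem_cauchyKernelStem_mul_constStem [IsScalarTower ℝ A A] (y c : A) :
    IsStem univ (fun z => cauchyKernelStem y z * constStem c z) := by
  intro z _
  have hd : ((starRingEnd ℂ z) ^ 2 - starRingEnd ℂ z * (trace y : ℂ) + (sqNorm y : ℂ))⁻¹ =
      starRingEnd ℂ (z ^ 2 - z * (trace y : ℂ) + (sqNorm y : ℂ))⁻¹ := by
    simp
  dsimp only
  rw [cauchyKernelStem_mul_constStem hd, cauchyKernelStem_mul_constStem rfl]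
  simp only [Complexification.conj, conj_re, conj_im, neg_mul, mul_neg, neg_neg]
  congr 1
  module

variable [IsScalarTower ℝ A A] [SMulCommClass ℝ A A] [StarModule ℝ A] [Nontrivial A]

theorem star_phi {J : A} (hJ : J ∈ imaginaryUnits A) (z : ℂ) :
    star (phi J z) = phi J (starRingEnd ℂ z) := by
  simp [phi, star_of_mem_imaginaryUnits hJ]

theorem trace_phi {J : A} (hJ : J ∈ imaginaryUnits A) (z : ℂ) : trace (phi J z) = 2 * z.re := by
  rw [trace, star_phi hJ]
  have : phi J z + phi J (starRingEnd ℂ z) = (2 * z.re) • (1 : A) := by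
    simp only [phi, conj_re, conj_im]; module
  rw [this, toReal_smul_one]

theorem sqNorm_phi {J : A} (hJ : J ∈ imaginaryUnits A) (z : ℂ) :
    sqNorm (phi J z) = z.re ^ 2 + z.im ^ 2 := by
  rw [sqNorm, star_phi hJ, phi_mul]
  have : z.re • phi J (starRingEnd ℂ z) + z.im • (J * phi J (starRingEnd ℂ z)) =
      (z.re ^ 2 + z.im ^ 2) • (1 : A) := by
    simp only [phi, conj_re, conj_im, mul_add, mul_smul_comm, hJ.2, mul_one]; module
  rw [this, toReal_smul_one]

theorem phi_injective {J : A} (hJ : J ∈ imaginaryUnits A) : Function.Injective (phi J) := by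
  intro z w h
  obtain ⟨h1, h2, -⟩ := phi_eq_phi hJ hJ h
  refine Complex.ext h1 (smul_left_injective ℝ (fun h0 : J = 0 => ?_) h2)
  have := hJ.2
  rw [h0, mul_zero, eq_comm, neg_eq_zero] at this
  exact one_ne_zero this

/-- A linear left inverse of `phi J` shows that both curves are differentiable at the same
parameters; elsewhere both derivatives are `0` by convention. -/
theorem deriv_phi_comp [FiniteDimensional ℝ A] {J : A} (hJ : J ∈ imaginaryUnits A) (γ : ℝ → ℂ)
    (t : ℝ) : deriv (fun t => phi J (γ t)) t = phi J (deriv γ t) := by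
  by_cases h : DifferentiableAt ℝ γ t
  · exact ((phiCLM J).hasFDerivAt.comp_hasDerivAt t h.hasDerivAt).deriv
  · rw [deriv_zero_of_not_differentiableAt h, deriv_zero_of_not_differentiableAt, phi]
    · simp
    · intro h'
      obtain ⟨ψ, hψ⟩ := ((phiCLM J).toLinearMap).exists_leftInverse_of_injective
        (LinearMap.ker_eq_bot.mpr (phi_injective hJ))
      refine h ?_
      have e : γ = fun t => ψ.toContinuousLinearMap (phi J (γ t)) :=
        funext fun t => (LinearMap.congr_fun hψ (γ t)).symm
      rw [e]
      exact ψ.toContinuousLinearMap.differentiableAt.comp t h'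

theorem preimage_phi_sliceDomain {D : Set ℂ} (hD : ∀ z ∈ D, starRingEnd ℂ z ∈ D) {J : A}
    (hJ : J ∈ imaginaryUnits A) : phi J ⁻¹' sliceDomain D J = D := by
  ext w
  constructor
  · rintro ⟨⟨K, hK, z, hz, h⟩, -⟩
    obtain ⟨h1, -, h2 | h2⟩ := phi_eq_phi hJ hK h
    · exact Complex.ext h1 h2 ▸ hz
    · have : w = starRingEnd ℂ z := Complex.ext (by simp [h1]) (by simp [h2])
      exact this ▸ hD z hz
  · intro hw
    refine ⟨⟨J, hJ, w, hw, rfl⟩, ?_⟩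
    exact Submodule.mem_span_pair.mpr ⟨w.re, w.im, rfl⟩

/-- The denominator factors as `(ζ - z)(ζ̄ - z)`, and each factor cancels against one of the two
classical kernels. This is the representation formula for the kernel, with the constant `c` kept to
the right of everything. -/
theorem sliceProduct_cauchyKernelStem [FiniteDimensional ℝ A] [IsAlternative A] {J K : A}
    (hJ : J ∈ imaginaryUnits A)
    (hK : K ∈ imaginaryUnits A) {z ζ : ℂ} (h1 : ζ ≠ z) (h2 : ζ ≠ starRingEnd ℂ z) (c : A) :
    sliceProduct (cauchyKernelStem (phi J ζ)) (constStem c) (phi K z) =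
      (representation J K).1 (phi J (ζ - z)⁻¹ * c) +
      (representation J K).2 (phi J (ζ - starRingEnd ℂ z)⁻¹ * c) := by
  set d : ℂ := (z ^ 2 - z * (trace (phi J ζ) : ℂ) + (sqNorm (phi J ζ) : ℂ))⁻¹ with hd
  set p := (ζ - z)⁻¹ with hp
  set q := (ζ - starRingEnd ℂ z)⁻¹ with hq
  have e1 : ζ - z ≠ 0 := sub_ne_zero.mpr h1
  have e2 : ζ - starRingEnd ℂ z ≠ 0 := sub_ne_zero.mpr h2
  have e2' : starRingEnd ℂ ζ - z ≠ 0 := fun h => e2 (by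
    have := congrArg (starRingEnd ℂ) h
    simpa using this)
  have hden : z ^ 2 - z * (trace (phi J ζ) : ℂ) + (sqNorm (phi J ζ) : ℂ) =
      (ζ - z) * (starRingEnd ℂ ζ - z) := by
    have h3 : ((2 * ζ.re : ℝ) : ℂ) = ζ + starRingEnd ℂ ζ := (add_conj ζ).symm
    have h4 : ((ζ.re ^ 2 + ζ.im ^ 2 : ℝ) : ℂ) = ζ * starRingEnd ℂ ζ := by
      rw [mul_conj, normSq_apply, sq, sq]
    rw [trace_phi hJ, sqNorm_phi hJ, h3, h4]
    ring
  have hp' : p = d * (starRingEnd ℂ ζ - z) := by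
    rw [hd, hden, hp]; field_simp
  have hq' : starRingEnd ℂ q = d * (ζ - z) := by
    rw [hd, hden, hq, map_inv₀, map_sub, conj_conj]; field_simp
  have r1 := congrArg Complex.re hp'
  have r2 := congrArg Complex.im hp'
  have r3 := congrArg Complex.re hq'
  have r4 := congrArg Complex.im hq'
  simp only [mul_re, mul_im, sub_re, sub_im, conj_re, conj_im] at r1 r2 r3 r4
  rw [neg_eq_iff_eq_neg] at r4
  rw [sliceProduct, sliceFunction_phi (isStem_cauchyKernelStem_mul_constStem _ _) hK (mem_univ z),
    cauchyKernelStem_mul_constStem hd.symm, star_phi hJ]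
  simp only [representation_fst_apply, representation_snd_apply, phi_mul, r1, r2, r3, r4, mul_add,
    mul_sub, mul_smul_comm, mul_mul_of_sq_eq_neg_one hJ.2, conj_re, conj_im, mul_neg]
  module

end Stem

end SliceCauchy

open SliceCauchy

/-! ### The slice formula from the planar formula at `z` and `z̄` -/

open Complex Metric Set Filter Topology in
theorem theorem3p4 {A : Type*} [NormedNonAssocRing A] [NormedSpace ℝ A] [FiniteDimensional ℝ A]
    [IsScalarTower ℝ A A] [SMulCommClass ℝ A A] [IsAlternative A] [StarRing A] [StarModule ℝ A]
    (hA : 1 < Module.finrank ℝ A)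
    (D : Set ℂ) (hD_open : IsOpen D) (hD_conn : IsConnected D) (hD_bdd : Bornology.IsBounded D)
    (hD_conj : ∀ z ∈ D, starRingEnd ℂ z ∈ D)
    (J : A) (hJ : J ∈ imaginaryUnits A)
    {m : ℕ} (γ : Fin m → ℝ → ℂ) (a b : Fin m → ℝ)
    (hγ : IsPiecewiseC1Boundary (phi J ⁻¹' sliceDomain D J) γ a b)
    (F : ℂ → Complexification A) (hF_stem : IsStem D F)
    (hF_re : IsC1OnClosure D (fun z => (F z).re)) (hF_im : IsC1OnClosure D (fun z => (F z).im))
    (x : A) (hx : x ∈ circularSet A D) :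
    (∀ i, IntervalIntegrable (boundaryIntegrand J F (fun t => phi J (γ i t)) x)
      volume (a i) (b i)) ∧
    IntegrableOn (areaIntegrand J F x) (phi J ⁻¹' sliceDomain D J) volume ∧
    sliceFunction F x =
      (1 / (2 * Real.pi)) •
          (∑ i, ∫ t in (a i)..(b i), boundaryIntegrand J F (fun t => phi J (γ i t)) x t) -
        (1 / (2 * Real.pi)) •
          ((2 : ℝ) • ∫ w in phi J ⁻¹' sliceDomain D J, areaIntegrand J F x w) := by 
  have : Nontrivial A := Module.nontrivial_of_finrank_pos (R := ℝ) (by omega)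
  rw [preimage_phi_sliceDomain hD_conj hJ] at hγ ⊢
  obtain ⟨K, hK, z, hz, rfl⟩ := hx
  have hzc := hD_conj z hz
  set g : ℂ → A := fun w => (F w).re + J * (F w).im with hg
  have hgC : IsC1OnClosure D g := hF_re.add_clm_comp hF_im hD_open (mulLeftCLM J)
  -- The boundary integrand evaluates `f` on the frontier, where the stem identity holds by
  -- continuity.
  have hFc := isStem_closure hF_stem hD_conj hF_re.continuousOn hF_im.continuousOn
  have hdisj := disjoint_left.mp (disjoint_frontier_iff_isOpen.mpr hD_open)
  set R₁ := (representation J K).1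
  set R₂ := (representation J K).2
  set u : ℂ → Fin m → ℝ → A := fun ζ i t =>
    phi J (-I * (deriv (γ i) t / (γ i t - ζ))) * g (γ i t) with hu
  set v : ℂ → ℂ → A := fun ζ w => phi J (w - ζ)⁻¹ * leftWirtinger J g w with hv
  have hui : ∀ ζ ∈ D, ∀ i, IntervalIntegrable (u ζ i) volume (a i) (b i) := fun ζ hζ i =>
    hγ.intervalIntegrable_phi_mul hD_open hgC.continuousOn J hζ i
  have hvi : ∀ ζ, IntegrableOn (v ζ) D := fun ζ =>
    integrableOn_phi_mul_leftWirtinger hD_open hD_bdd hgC J ζ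
  have hB : ∀ i, ∀ t ∈ uIcc (a i) (b i), boundaryIntegrand J F (fun t => phi J (γ i t)) (phi K z) t =
      R₁ (u z i t) + R₂ (u (starRingEnd ℂ z) i t) := fun i t ht => by
    rw [uIcc_of_le (hγ.jordan i).lt.le] at ht
    have hf := hγ.mem_frontier ht
    have hne : ∀ ζ ∈ D, γ i t ≠ ζ := fun ζ hζ h => hdisj hf (by rwa [h])
    rw [boundaryIntegrand, deriv_phi_comp hJ, neg_mul_phi hJ.2,
      sliceFunction_phi hFc hJ (frontier_subset_closure hf),
      sliceProduct_cauchyKernelStem hJ hK (hne z hz) (hne _ hzc), phi_mul_phi_mul hJ.2, phi_mul_phi_mul hJ.2]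
    have hcomm : ∀ k d : ℂ, k * (-I * d) = -I * (d * k) := fun k d => by ring
    simp only [hu, hg, div_eq_mul_inv, hcomm]
    rfl
  -- The kernel identity fails to apply only at the two singular points `z` and `z̄`, a null set.
  have hA' : ∀ᵐ w ∂volume.restrict D, areaIntegrand J F (phi K z) w =
      R₁ (v z w) + R₂ (v (starRingEnd ℂ z) w) := by
    have h0 : ∀ ζ : ℂ, ∀ᵐ w ∂volume.restrict D, w ≠ ζ := fun ζ =>
      ae_restrict_of_ae (by simp [ae_iff])
    filter_upwards [h0 z, h0 (starRingEnd ℂ z), ae_restrict_mem hD_open.measurableSet]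
      with w h1 h2 hw
    rw [areaIntegrand, sliceProduct_cauchyKernelStem hJ hK h1 h2, sliceDbar,
      sliceFunction_phi (isStem_dbarStem hF_stem hD_open hD_conj hF_re hF_im) hJ hw,
      dbarStem_re_add_mul_im hJ.2 (hF_re.differentiableAt hD_open hw)
        (hF_im.differentiableAt hD_open hw)]
  have hRu : ∀ (R : A →L[ℝ] A), ∀ ζ ∈ D, ∀ i,
      IntervalIntegrable (fun t => R (u ζ i t)) volume (a i) (b i) := fun R ζ hζ i =>
    ⟨R.integrable_comp (hui ζ hζ i).1, R.integrable_comp (hui ζ hζ i).2⟩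
  have hRv : ∀ (R : A →L[ℝ] A) ζ, IntegrableOn (fun w => R (v ζ w)) D := fun R ζ =>
    R.integrable_comp (hvi ζ)
  refine ⟨fun i => ?_, ?_, ?_⟩
  · refine ((hRu R₁ z hz i).add (hRu R₂ _ hzc i)).congr fun t ht => ?_
    exact (hB i t (uIoc_subset_uIcc ht)).symm
  · exact (integrable_congr hA').mpr ((hRv R₁ z).add (hRv R₂ _))
  · have hBi : ∀ i, ∫ t in a i..b i, boundaryIntegrand J F (fun t => phi J (γ i t)) (phi K z) t =
        R₁ (∫ t in a i..b i, u z i t) + R₂ (∫ t in a i..b i, u (starRingEnd ℂ z) i t) := fun i => by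
      rw [intervalIntegral.integral_congr (hB i),
        intervalIntegral.integral_add (hRu R₁ z hz i) (hRu R₂ _ hzc i),
        R₁.intervalIntegral_comp_comm (hui z hz i), R₂.intervalIntegral_comp_comm (hui _ hzc i)]
    have hAi : ∫ w in D, areaIntegrand J F (phi K z) w =
        R₁ (∫ w in D, v z w) + R₂ (∫ w in D, v (starRingEnd ℂ z) w) := by
      rw [integral_congr_ae hA', integral_add (hRv R₁ z) (hRv R₂ _),
        R₁.integral_comp_comm (hvi z), R₂.integral_comp_comm (hvi _)]
    rw [sliceFunction_phi hF_stem hK hz, re_add_mul_im_eq_representation hJ.2 hF_stem hz]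
    change R₁ (g z) + R₂ (g (starRingEnd ℂ z)) = _
    rw [hγ.leftCauchyPompeiu hD_open hD_bdd hgC hJ.2 hz,
      hγ.leftCauchyPompeiu hD_open hD_bdd hgC hJ.2 hzc, hAi]
    simp only [hBi, Finset.sum_add_distrib, map_sub, map_smul, map_sum, hu, hv]
    module
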